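/- Two circles are externally tangent if they bound closed discs with disjoint interiors that touch at a point; a line counts as a circle (its disc being a closed half-plane), but two parallel lines do not count as tangent. For pairwise externally tangent circles $A,B,C$, let the \emph{successor} of $(A,B,C)$ be the circle that is externally tangent to all three and lies in the bounded region between them; equivalently, it is the externally tangent circle that is smaller than each of $A,B,C$. Let $C_0$ be a circle with center $c_0$. For a circle $C$ with center $c$ that is externally tangent to $C_0$, let $\alpha(C)$ be the angle of the vector $v(C)=c-c_0$ with the positive $x$-axis (if $C$ is a line, $v(C)$ is the unit normal of $C$ pointing away from $C_0$), and let $\ell^{1/2}(C)=\mathbb{R}\,v(C)^{1/2}$ be the real line spanned by a complex square root of $v(C)$, where $\mathbb{R}^2=\mathbb{C}$. For tangent circles $C,C'$ that are externally tangent to $C_0$, let $s(C,C')$ be the successor of $(C_0,C,C')$. If $C_0,C_1,C_2$ are pairwise externally tangent, let $\mathcal{C}$ be the smallest set of circles that contains $C_1,C_2$ and contains $s(C,C')$ for all tangent $C,C'\in\mathcal{C}$. An \emph{Apollonian curve} for $(C_0,C_1,C_2)$ is a continuous curve $\gamma:[\alpha(C_1),\alpha(C_2)]\to\mathbb{R}^2$,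 defined on the interval of angles (of length less than $\pi$) that faces the gap between the three circles, such that $$\gamma(\alpha(C))-\gamma(\alpha(C'))\in\ell^{1/2}(s(C,C'))\quad\text{for all tangent } C,C'\in\mathcal{C}.$$ Let $C_1,C_2,C_3$ be pairwise externally tangent circles and let $C_0$ be externally tangent to each of them. Let $\gamma_{12},\gamma_{23},\gamma_{31}$ be Apollonian curves for $(C_0,C_1,C_2)$, $(C_0,C_2,C_3)$, $(C_0,C_3,C_1)$ with matching endpoints $$p_1=\gamma_{31}(\alpha(C_1))=\gamma_{12}(\alpha(C_1)),\quad p_2=\gamma_{12}(\alpha(C_2))=\gamma_{23}(\alpha(C_2)),\quad p_3=\gamma_{23}(\alpha(C_3))=\gamma_{31}(\alpha(C_3)).$$ The bounded region $\mathcal{T}$ enclosed by the images of these curves is called an \emph{Apollonian triangle} with vertices $p_1,p_2,p_3$; it is \emph{proper} if $C_0$ is the successor of $(C_1,C_2,C_3)$. \textbf{Lemma.} A proper Apollonian triangle $\mathcal{T}$ with vertices $p_1,p_2,p_3$ has area exactly $\frac47 A(T)$, where $A(T)$ is the area of the Euclidean triangle $T=\triangle p_1p_2p_3$. -/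

import Mathlib

/- The plane `ℝ²` is identified with `ℂ`; areas are Lebesgue measure on `ℂ`.  A circle is given
by its closed disc and a line by one of its two closed half-planes, so that an external tangency
is a tangency of two such closed sets with disjoint interiors. -/

namespace Apollonian

/-- A round closed disc (equivalently, a proper circle). -/
structure RoundDisc where
  center : ℂ
  radius : ℝ
  radius_pos : 0 < radius

/-- A generalized closed disc: a round disc, or the closed half-plane
`{z | d ≤ ⟪u, z⟫}` with unit inner normal `u`. Its boundary is a circle or a line. -/
inductive GenDisc where
  | disc (D : RoundDisc) : GenDisc
  | halfPlane (u : ℂ) (hu : ‖u‖ = 1) (d : ℝ) : GenDisc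

/-- External tangency. Two lines are never externally tangent in the finite plane. -/
def ExternallyTangent : GenDisc → GenDisc → Prop
  | .disc D, .disc E => dist D.center E.center = D.radius + E.radius
  | .disc D, .halfPlane u _ d => inner ℝ u D.center + D.radius = d
  | .halfPlane u _ d, .disc D => inner ℝ u D.center + D.radius = d
  | .halfPlane _ _ _, .halfPlane _ _ _ => False

/-- The curvature: the inverse of the radius, and `0` for a line. -/
noncomputable def GenDisc.curvature : GenDisc → ℝ
  | .disc D => D.radius⁻¹
  | .halfPlane _ _ _ => 0

/-- `S` is smaller than `A` (a line has infinite radius). -/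
def IsSmaller (S : RoundDisc) (A : GenDisc) : Prop :=
  A.curvature < (GenDisc.disc S).curvature

/-- For pairwise externally tangent `A`, `B`, `C`: the circle `S` is their successor, i.e. the
circle that touches all three externally and sits in the bounded gap between them. Among the at
most two circles that touch all three externally it is the one that is smaller than each of
`A`, `B`, `C`. -/
structure IsSuccessor (A B C : GenDisc) (S : RoundDisc) : Prop where
  tangent₁ : ExternallyTangent (.disc S) A
  tangent₂ : ExternallyTangent (.disc S) B
  tangent₃ : ExternallyTangent (.disc S) C
  smaller₁ : IsSmaller S A
  smaller₂ : IsSmaller S B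
  smaller₃ : IsSmaller S C

/-- The smallest set of circles that contains `C₁`, `C₂` and, with any two tangent members
`C`, `C'`, the successor of `(C₀, C, C')`. -/
inductive Family (C₀ : RoundDisc) (C₁ C₂ : GenDisc) : GenDisc → Prop
  | left : Family C₀ C₁ C₂ C₁
  | right : Family C₀ C₁ C₂ C₂
  | succ {C C' : GenDisc} {S : RoundDisc} :
      Family C₀ C₁ C₂ C → Family C₀ C₁ C₂ C' → ExternallyTangent C C' →
      IsSuccessor (.disc C₀) C C' S → Family C₀ C₁ C₂ (.disc S)

/-- The vector from the center of `C₀` to the center of `C`. For a line, whose center is at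
infinity, the unit vector orthogonal to the line and pointing away from `C₀`. -/
noncomputable def centerVec (C₀ : RoundDisc) : GenDisc → ℂ
  | .disc D => D.center - C₀.center
  | .halfPlane u _ _ => u

/-- The angle `α(C)`, modulo `2π`, of the vector from `C₀` to `C` with the positive `x`-axis. -/
noncomputable def angle (C₀ : RoundDisc) (C : GenDisc) : Real.Angle :=
  (Complex.arg (centerVec C₀ C) : Real.Angle)

/-- The real line through `0` spanned by a complex square root of `v` (for `v ≠ 0`). -/
def sqrtLine (v : ℂ) : Set ℂ :=
  {z | ∃ w : ℂ, w ^ 2 = v ∧ ∃ t : ℝ, z = (t : ℂ) * w}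

/-- An Apollonian curve associated to a pairwise externally tangent ordered triple
`(C₀, C₁, C₂)`. It is parametrized by the angles between `a = α(C₁)` and `b = α(C₂)` that face
the gap between the three circles, an interval of length less than `π`. -/
structure ApollonianCurve (C₀ : RoundDisc) (C₁ C₂ : GenDisc) where
  /-- a determination of `α(C₁)` -/
  a : ℝ
  /-- a determination of `α(C₂)` -/
  b : ℝ
  /-- the curve; only its values between `a` and `b` matter -/
  γ : ℝ → ℂ
  angle_a : (a : Real.Angle) = angle C₀ C₁
  angle_b : (b : Real.Angle) = angle C₀ C₂
  length_lt : |b - a| < Real.pi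
  continuousOn : ContinuousOn γ (Set.uIcc a b)
  sub_mem : ∀ C C' : GenDisc, Family C₀ C₁ C₂ C → Family C₀ C₁ C₂ C' →
    ExternallyTangent C C' → ∀ S : RoundDisc, IsSuccessor (.disc C₀) C C' S →
    ∀ t ∈ Set.uIcc a b, ∀ t' ∈ Set.uIcc a b,
      (t : Real.Angle) = angle C₀ C → (t' : Real.Angle) = angle C₀ C' →
      γ t - γ t' ∈ sqrtLine (S.center - C₀.center)

namespace ApollonianCurve

variable {C₀ : RoundDisc} {C₁ C₂ : GenDisc}

/-- The endpoint `γ(α(C₁))`. -/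
def source (g : ApollonianCurve C₀ C₁ C₂) : ℂ := g.γ g.a

/-- The endpoint `γ(α(C₂))`. -/
def target (g : ApollonianCurve C₀ C₁ C₂) : ℂ := g.γ g.b

/-- The image of the curve. -/
def image (g : ApollonianCurve C₀ C₁ C₂) : Set ℂ := g.γ '' Set.uIcc g.a g.b

end ApollonianCurve

/-- The region enclosed by `K`: the union of the bounded connected components of the complement
of `K`. -/
def enclosedRegion (K : Set ℂ) : Set ℂ :=
  {z | z ∉ K ∧ Bornology.IsBounded (connectedComponentIn Kᶜ z)}

/-- `T` is an Apollonian triangle, with vertices `p₁`, `p₂`, `p₃`, corresponding to the pairwise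
externally tangent `C₁`, `C₂`, `C₃` and to `C₀` externally tangent to each of them: the bounded
region enclosed by Apollonian curves for `(C₀, C₁, C₂)`, `(C₀, C₂, C₃)`, `(C₀, C₃, C₁)` with
matching endpoints. -/
structure IsApollonianTriangle (C₀ : RoundDisc) (C₁ C₂ C₃ : GenDisc) (p₁ p₂ p₃ : ℂ)
    (T : Set ℂ) : Prop where
  tangent₁₂ : ExternallyTangent C₁ C₂
  tangent₂₃ : ExternallyTangent C₂ C₃
  tangent₃₁ : ExternallyTangent C₃ C₁
  tangent₀₁ : ExternallyTangent (.disc C₀) C₁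
  tangent₀₂ : ExternallyTangent (.disc C₀) C₂
  tangent₀₃ : ExternallyTangent (.disc C₀) C₃
  enclosed : ∃ (γ₁₂ : ApollonianCurve C₀ C₁ C₂) (γ₂₃ : ApollonianCurve C₀ C₂ C₃)
      (γ₃₁ : ApollonianCurve C₀ C₃ C₁),
    γ₃₁.target = p₁ ∧ γ₁₂.source = p₁ ∧
    γ₁₂.target = p₂ ∧ γ₂₃.source = p₂ ∧
    γ₂₃.target = p₃ ∧ γ₃₁.source = p₃ ∧
    T = enclosedRegion (γ₁₂.image ∪ γ₂₃.image ∪ γ₃₁.image)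

/-- An Apollonian triangle corresponding to `C₁`, `C₂`, `C₃` and `C₀` is proper if `C₀` is the
successor of `C₁`, `C₂`, `C₃`. -/
def IsProper (C₀ : RoundDisc) (C₁ C₂ C₃ : GenDisc) : Prop :=
  IsSuccessor C₁ C₂ C₃ C₀

end Apollonian

/-! Take as spinor of a circle `C` tangent to `C₀` a square root `u` of the vector from `C₀` to `C`,
scaled such that `‖u‖²` is the sum of the curvatures of `C₀` and `C`. Then tangency of two circles
is a condition on the area form of their spinors `u` and `v`, and their successor has the spinor
`u + v`. If the chord of an Apollonian curve between these circles is `λ (u + v)`, then it is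
divided at the successor into multiples of `2u + v` and `u + 2v`, both of which must be the
multiples by `λ / 3`. So every Apollonian curve is an affine image of one self-similar model curve.
The region below the model curve is the union of `2 / 3` times the corner triangle and of two copies
of itself of one ninth the area, hence has `(4 / 9) / (1 - 2 / 9) = 4 / 7` of the area of that
triangle. For a proper Apollonian triangle the three spinors can be chosen with sum zero, which
makes the whole boundary an affine image of three copies of the model curve around the origin. -/

namespace Apollonian

open MeasureTheory Set
open Complex (I)
open scoped NNReal Topology Filter Uniformity Pointwise

attribute [local instance] Complex.finrank_real_complex_fact

local notation "ω" => Complex.orientation.areaForm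

lemma areaForm_eq (x y : ℂ) : ω x y = x.re * y.im - x.im * y.re := by
  rw [Complex.areaForm]; simp [sub_eq_add_neg]

lemma inner_eq (x y : ℂ) : inner ℝ x y = x.re * y.re + x.im * y.im := by
  rw [Complex.inner]; simp [mul_comm]

/-! ### Affine frames -/

/-- The affine frame with origin `o` and axes `x`, `y`, as the affine map of the plane that sends
the standard frame `0`, `1`, `I` to `o`, `o + x`, `o + y`. -/
noncomputable def frame (o x y : ℂ) : ℂ →ᵃ[ℝ] ℂ :=
  (Complex.reLm.smulRight x + Complex.imLm.smulRight y).toAffineMap + AffineMap.const ℝ ℂ o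

section Frame

variable {o x y : ℂ}

lemma frame_apply (o x y z : ℂ) : frame o x y z = o + (z.re • x + z.im • y) := by
  simp [frame, add_comm]

@[simp] lemma frame_zero (o x y : ℂ) : frame o x y 0 = o := by simp [frame_apply]

@[simp] lemma frame_one (o x y : ℂ) : frame o x y 1 = o + x := by simp [frame_apply]

@[simp] lemma frame_I (o x y : ℂ) : frame o x y I = o + y := by simp [frame_apply]

lemma frame_smul (s : ℝ) (z : ℂ) : frame 0 x y (s • z) = s • frame 0 x y z := by
  simp only [frame_apply, Complex.smul_re, Complex.smul_im, smul_eq_mul, smul_add, mul_smul,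
    zero_add]

lemma lipschitzWith_frame (o x y : ℂ) : LipschitzWith (‖x‖₊ + ‖y‖₊) (frame o x y) := by
  refine LipschitzWith.of_dist_le_mul fun z w => ?_
  have hsub : frame o x y z - frame o x y w = (z - w).re • x + (z - w).im • y := by
    simp only [frame_apply, Complex.sub_re, Complex.sub_im, sub_smul]; abel
  rw [dist_eq_norm, dist_eq_norm, hsub]
  calc ‖(z - w).re • x + (z - w).im • y‖
      ≤ |(z - w).re| * ‖x‖ + |(z - w).im| * ‖y‖ := by
        simpa only [norm_smul, Real.norm_eq_abs] using
          norm_add_le ((z - w).re • x) ((z - w).im • y)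
    _ ≤ ‖z - w‖ * ‖x‖ + ‖z - w‖ * ‖y‖ := by
        gcongr
        exacts [Complex.abs_re_le_norm _, Complex.abs_im_le_norm _]
    _ = (‖x‖₊ + ‖y‖₊ : ℝ≥0) * ‖z - w‖ := by push_cast; ring

@[fun_prop]
lemma continuous_frame (o x y : ℂ) : Continuous (frame o x y) :=
  (lipschitzWith_frame o x y).continuous

lemma det_frame_linear (o x y : ℂ) : (frame o x y).linear.det = ω x y := by
  rw [← LinearMap.det_toMatrix Complex.basisOneI, Matrix.det_fin_two, areaForm_eq]
  simp [LinearMap.toMatrix_apply, frame, mul_comm]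

lemma volume_frame_image (o x y : ℂ) (s : Set ℂ) :
    volume (frame o x y '' s) = ENNReal.ofReal |ω x y| * volume s := by
  have himage : frame o x y '' s = (o + ·) '' ((frame o x y).linear '' s) := by
    rw [image_image]
    exact image_congr fun z _ => by simp [frame, add_comm]
  rw [himage, image_add_left, measure_preimage_add, Measure.addHaar_image_linearMap,
    det_frame_linear]

lemma bijective_frame (h : ω x y ≠ 0) : Function.Bijective (frame o x y) :=
  (frame o x y).linear_bijective_iff.mp
    (LinearMap.equivOfDetNeZero (frame o x y).linear (by rwa [det_frame_linear])).bijective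

lemma exists_homeomorph_eq_frame (h : ω x y ≠ 0) : ∃ e : ℂ ≃ₜ ℂ, ⇑e = frame o x y :=
  ⟨(AffineEquiv.toContinuousAffineEquiv (𝕜 := ℝ)
    (AffineEquiv.ofBijective (bijective_frame h))).toHomeomorph, rfl⟩

end Frame

/-! ### Connectedness of self-similar sets -/

section SelfSimilar

variable {α : Type*} [PseudoMetricSpace α] {K : Set α} {f g : α → α} {c : ℝ≥0}

/-- A locally constant function on `K` is constant at some scale `cⁿ diam K`, by compactness.
Composing it with `f` and with `g` improves the scale by a factor `c⁻¹`. -/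
lemma isPreconnected_of_subset_image_union (hK : IsCompact K) (hc : c < 1)
    (hf : LipschitzOnWith c f K) (hg : LipschitzOnWith c g K) (hfK : MapsTo f K K)
    (hgK : MapsTo g K K) (hcover : K ⊆ f '' K ∪ g '' K) {a b : α} (ha : a ∈ K) (hb : b ∈ K)
    (hab : f b = g a) : IsPreconnected K := by
  have constant_of_scale : ∀ (n : ℕ) (φ : α → Bool),
      (∀ x ∈ K, ∀ y ∈ K, dist x y ≤ c ^ n * Metric.diam K → φ x = φ y) →
      ∀ x ∈ K, ∀ y ∈ K, φ x = φ y := by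
    intro n
    induction n with
    | zero =>
      intro φ hφ x hx y hy
      exact hφ x hx y hy (by simpa using Metric.dist_le_diam_of_mem hK.isBounded hx hy)
    | succ n ih =>
      intro φ hφ
      have constant_comp : ∀ h : α → α, LipschitzOnWith c h K → MapsTo h K K →
          ∀ x ∈ K, ∀ y ∈ K, φ (h x) = φ (h y) := fun h hh hhK =>
        ih (φ ∘ h) fun x hx y hy hxy => hφ _ (hhK hx) _ (hhK hy) <|
          (hh.dist_le_mul x hx y hy).trans <| by
            rw [pow_succ', mul_assoc]; gcongr
      have eq_join : ∀ x ∈ K, φ x = φ (f b) := by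
        intro x hx
        obtain ⟨y, hy, rfl⟩ | ⟨y, hy, rfl⟩ := hcover hx
        · exact constant_comp f hf hfK y hy b hb
        · exact hab ▸ constant_comp g hg hgK y hy a ha
      exact fun x hx y hy => (eq_join x hx).trans (eq_join y hy).symm
  refine isPreconnected_of_forall_constant fun φ hφ => ?_
  have hφ_uniform : {p : α × α | φ p.1 = φ p.2} ∈ 𝓤 α ⊓ 𝓟 (K ×ˢ K) :=
    hK.uniformContinuousOn_of_continuous hφ
      (DiscreteUniformity.relId_mem_uniformity _)
  obtain ⟨δ, hδ, hφδ⟩ :=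
    (Metric.uniformity_basis_dist.inf_principal _).mem_iff.mp hφ_uniform
  obtain ⟨n, hn⟩ : ∃ n : ℕ, (c : ℝ) ^ n * Metric.diam K < δ :=
    (((tendsto_pow_atTop_nhds_zero_of_lt_one c.2 hc).mul_const _).eventually_lt_const
      (by simpa using hδ)).exists
  exact constant_of_scale n φ fun x hx y hy hxy => @hφδ (x, y) ⟨hxy.trans_lt hn, hx, hy⟩

end SelfSimilar

/-! ### The model curve -/

/-- The first of the two contractions that generate the model curve: it maps the corner `0, 1, I`
to the corner cut off at `1` by trisecting the segment from `1` to `I` towards `0`. -/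
noncomputable def cutLeft : ℂ →ᵃ[ℝ] ℂ := frame (2 / 3) (1 / 3) ((I - 1) / 3)

/-- The mirror image of `cutLeft` in the diagonal. -/
noncomputable def cutRight : ℂ →ᵃ[ℝ] ℂ := frame (2 / 3 * I) ((1 - I) / 3) (I / 3)

/-- The points obtained from `1` and `I` by finitely many applications of the two contractions. -/
inductive IsCurveVertex : ℂ → Prop
  | one : IsCurveVertex 1
  | I : IsCurveVertex I
  | cutLeft {z : ℂ} : IsCurveVertex z → IsCurveVertex (cutLeft z)
  | cutRight {z : ℂ} : IsCurveVertex z → IsCurveVertex (cutRight z)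

/-- The self-similar curve from `1` to `I` of which every Apollonian curve is an affine image. -/
def modelCurve : Set ℂ := closure {z | IsCurveVertex z}

/-- The closed triangle with vertices `0`, `1`, `I`. -/
def cornerTriangle : Set ℂ := {z | 0 ≤ z.re ∧ 0 ≤ z.im ∧ z.re + z.im ≤ 1}

section ModelCurve

variable {z w : ℂ}

@[simp] lemma cutLeft_re (z : ℂ) : (cutLeft z).re = 2 / 3 + (z.re - z.im) / 3 := by
  simp [cutLeft, frame_apply]; ring

@[simp] lemma cutLeft_im (z : ℂ) : (cutLeft z).im = z.im / 3 := by
  simp [cutLeft, frame_apply]; ring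

@[simp] lemma cutRight_re (z : ℂ) : (cutRight z).re = z.re / 3 := by
  simp [cutRight, frame_apply]; ring

@[simp] lemma cutRight_im (z : ℂ) : (cutRight z).im = 2 / 3 + (z.im - z.re) / 3 := by
  simp [cutRight, frame_apply]; ring

@[simp] lemma cutLeft_one : cutLeft 1 = 1 := by apply Complex.ext <;> norm_num

@[simp] lemma cutRight_I : cutRight I = I := by apply Complex.ext <;> norm_num

lemma cutLeft_I_eq_cutRight_one : cutLeft I = cutRight 1 := by apply Complex.ext <;> norm_num

lemma norm_I_sub_one_div_three_le : ‖(I - 1) / 3‖ ≤ 1 / 2 := by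
  rw [← abs_norm, ← abs_of_nonneg (by norm_num : (0 : ℝ) ≤ 1 / 2), ← sq_le_sq, Complex.sq_norm]
  norm_num [Complex.normSq_apply]

lemma lipschitzWith_cutLeft : LipschitzWith (5 / 6) cutLeft := by
  refine (lipschitzWith_frame _ _ _).weaken (NNReal.coe_le_coe.mp ?_)
  have := norm_I_sub_one_div_three_le
  push_cast
  norm_num
  norm_num at this
  linarith

lemma lipschitzWith_cutRight : LipschitzWith (5 / 6) cutRight := by
  refine (lipschitzWith_frame _ _ _).weaken (NNReal.coe_le_coe.mp ?_)
  have := norm_I_sub_one_div_three_le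
  rw [norm_div, norm_sub_rev, ← norm_div] at this
  push_cast
  norm_num
  norm_num at this
  linarith

lemma isClosed_cornerTriangle : IsClosed cornerTriangle :=
  (isClosed_le continuous_const Complex.continuous_re).inter <|
    (isClosed_le continuous_const Complex.continuous_im).inter <|
      isClosed_le (Complex.continuous_re.add Complex.continuous_im) continuous_const

lemma isCompact_cornerTriangle : IsCompact cornerTriangle := by
  refine Metric.isCompact_of_isClosed_isBounded isClosed_cornerTriangle
    (isBounded_iff_forall_norm_le.mpr ⟨1, fun z ⟨hre, him, hsum⟩ => ?_⟩)
  calc ‖z‖ ≤ |z.re| + |z.im| := Complex.norm_le_abs_re_add_abs_im z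
    _ ≤ 1 := by rwa [abs_of_nonneg hre, abs_of_nonneg him]

lemma one_mem_cornerTriangle : (1 : ℂ) ∈ cornerTriangle := by simp [cornerTriangle]

lemma I_mem_cornerTriangle : I ∈ cornerTriangle := by simp [cornerTriangle]

lemma cutLeft_mem_cornerTriangle (hz : z ∈ cornerTriangle) : cutLeft z ∈ cornerTriangle := by
  obtain ⟨hre, him, hsum⟩ := hz
  refine ⟨?_, ?_, ?_⟩ <;> simp only [cutLeft_re, cutLeft_im] <;> linarith

lemma cutRight_mem_cornerTriangle (hz : z ∈ cornerTriangle) : cutRight z ∈ cornerTriangle := by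
  obtain ⟨hre, him, hsum⟩ := hz
  refine ⟨?_, ?_, ?_⟩ <;> simp only [cutRight_re, cutRight_im] <;> linarith

lemma eq_of_cutLeft_re_le_cutRight_re (hz : z ∈ cornerTriangle) (hw : w ∈ cornerTriangle)
    (h : (cutLeft z).re ≤ (cutRight w).re) : z = I ∧ w = 1 := by
  obtain ⟨hz0, hz1, hz2⟩ := hz
  obtain ⟨hw0, hw1, hw2⟩ := hw
  rw [cutLeft_re, cutRight_re] at h
  constructor <;> apply Complex.ext <;> simp only [Complex.I_re, Complex.I_im, Complex.one_re,
    Complex.one_im] <;> linarith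

lemma eq_of_cutRight_im_le_cutLeft_im (hz : z ∈ cornerTriangle) (hw : w ∈ cornerTriangle)
    (h : (cutRight w).im ≤ (cutLeft z).im) : z = I ∧ w = 1 := by
  obtain ⟨hz0, hz1, hz2⟩ := hz
  obtain ⟨hw0, hw1, hw2⟩ := hw
  rw [cutLeft_im, cutRight_im] at h
  constructor <;> apply Complex.ext <;> simp only [Complex.I_re, Complex.I_im, Complex.one_re,
    Complex.one_im] <;> linarith

lemma IsCurveVertex.mem_cornerTriangle (hz : IsCurveVertex z) : z ∈ cornerTriangle := by
  induction hz with
  | one => exact one_mem_cornerTriangle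
  | I => exact I_mem_cornerTriangle
  | cutLeft _ ih => exact cutLeft_mem_cornerTriangle ih
  | cutRight _ ih => exact cutRight_mem_cornerTriangle ih

lemma modelCurve_subset_cornerTriangle : modelCurve ⊆ cornerTriangle :=
  closure_minimal (fun _ => IsCurveVertex.mem_cornerTriangle) isClosed_cornerTriangle

lemma isCompact_modelCurve : IsCompact modelCurve :=
  isCompact_cornerTriangle.of_isClosed_subset isClosed_closure modelCurve_subset_cornerTriangle

lemma one_mem_modelCurve : (1 : ℂ) ∈ modelCurve := subset_closure IsCurveVertex.one

lemma I_mem_modelCurve : I ∈ modelCurve := subset_closure IsCurveVertex.I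

lemma mapsTo_cutLeft_modelCurve : MapsTo cutLeft modelCurve modelCurve :=
  MapsTo.closure (fun _ => IsCurveVertex.cutLeft) lipschitzWith_cutLeft.continuous

lemma mapsTo_cutRight_modelCurve : MapsTo cutRight modelCurve modelCurve :=
  MapsTo.closure (fun _ => IsCurveVertex.cutRight) lipschitzWith_cutRight.continuous

lemma modelCurve_eq_union : modelCurve = cutLeft '' modelCurve ∪ cutRight '' modelCurve := by
  refine subset_antisymm (closure_minimal ?_ ?_)
    (union_subset mapsTo_cutLeft_modelCurve.image_subset mapsTo_cutRight_modelCurve.image_subset)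
  · rintro _ (_ | _ | hz | hz)
    · exact Or.inl ⟨1, one_mem_modelCurve, cutLeft_one⟩
    · exact Or.inr ⟨I, I_mem_modelCurve, cutRight_I⟩
    · exact Or.inl (mem_image_of_mem _ (subset_closure hz))
    · exact Or.inr (mem_image_of_mem _ (subset_closure hz))
  · exact ((isCompact_modelCurve.image lipschitzWith_cutLeft.continuous).union
      (isCompact_modelCurve.image lipschitzWith_cutRight.continuous)).isClosed

lemma isPreconnected_modelCurve : IsPreconnected modelCurve :=
  isPreconnected_of_subset_image_union isCompact_modelCurve
    (NNReal.coe_lt_coe.mp (by norm_num)) lipschitzWith_cutLeft.lipschitzOnWith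
    lipschitzWith_cutRight.lipschitzOnWith mapsTo_cutLeft_modelCurve mapsTo_cutRight_modelCurve
    modelCurve_eq_union.subset one_mem_modelCurve I_mem_modelCurve cutLeft_I_eq_cutRight_one

lemma two_thirds_le_re_add_im (hz : z ∈ modelCurve) : 2 / 3 ≤ z.re + z.im := by
  obtain ⟨w, hw, rfl⟩ | ⟨w, hw, rfl⟩ := modelCurve_eq_union.subset hz
  · have := (modelCurve_subset_cornerTriangle hw).1
    rw [cutLeft_re, cutLeft_im]; linarith
  · have := (modelCurve_subset_cornerTriangle hw).2.1
    rw [cutRight_re, cutRight_im]; linarith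

lemma zero_notMem_modelCurve : (0 : ℂ) ∉ modelCurve := fun h => by
  have := two_thirds_le_re_add_im h
  norm_num at this

lemma dist_le_of_re_le_of_im_le (n : ℕ) : ∀ z ∈ modelCurve, ∀ w ∈ modelCurve,
    z.re ≤ w.re → z.im ≤ w.im → dist z w ≤ (5 / 6) ^ n * Metric.diam modelCurve := by
  induction n with
  | zero =>
    intro z hz w hw _ _
    simpa using Metric.dist_le_diam_of_mem isCompact_modelCurve.isBounded hz hw
  | succ n ih =>
    have dist_image_le {f : ℂ → ℂ} (hf : LipschitzWith (5 / 6) f) {z w : ℂ}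
        (h : dist z w ≤ (5 / 6) ^ n * Metric.diam modelCurve) :
        dist (f z) (f w) ≤ (5 / 6) ^ (n + 1) * Metric.diam modelCurve := by
      rw [pow_succ', mul_assoc]
      exact (hf.dist_le_mul z w).trans (mul_le_mul_of_nonneg_left h (by positivity))
    intro z hz w hw hre him
    obtain ⟨z', hz', rfl⟩ | ⟨z', hz', rfl⟩ := modelCurve_eq_union.subset hz <;>
      obtain ⟨w', hw', rfl⟩ | ⟨w', hw', rfl⟩ := modelCurve_eq_union.subset hw
    · simp only [cutLeft_re, cutLeft_im] at hre him
      exact dist_image_le lipschitzWith_cutLeft (ih z' hz' w' hw' (by linarith) (by linarith))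
    · obtain ⟨rfl, rfl⟩ := eq_of_cutLeft_re_le_cutRight_re
        (modelCurve_subset_cornerTriangle hz') (modelCurve_subset_cornerTriangle hw') hre
      rw [cutLeft_I_eq_cutRight_one, dist_self]; positivity
    · obtain ⟨rfl, rfl⟩ := eq_of_cutRight_im_le_cutLeft_im
        (modelCurve_subset_cornerTriangle hw') (modelCurve_subset_cornerTriangle hz') him
      rw [cutLeft_I_eq_cutRight_one, dist_self]; positivity
    · simp only [cutRight_re, cutRight_im] at hre him
      exact dist_image_le lipschitzWith_cutRight (ih z' hz' w' hw' (by linarith) (by linarith))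

lemma eq_of_re_le_of_im_le (hz : z ∈ modelCurve) (hw : w ∈ modelCurve) (hre : z.re ≤ w.re)
    (him : z.im ≤ w.im) : z = w := by
  have hlim : Filter.Tendsto (fun n : ℕ => (5 / 6 : ℝ) ^ n * Metric.diam modelCurve)
      Filter.atTop (𝓝 0) := by
    simpa using (tendsto_pow_atTop_nhds_zero_of_lt_one (r := (5 / 6 : ℝ)) (by norm_num)
      (by norm_num)).mul_const (Metric.diam modelCurve)
  exact dist_le_zero.mp
    (ge_of_tendsto' hlim fun n => dist_le_of_re_le_of_im_le n z hz w hw hre him)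

lemma eq_I_of_re_eq_zero (hz : z ∈ modelCurve) (h : z.re = 0) : z = I :=
  eq_of_re_le_of_im_le hz I_mem_modelCurve (by simp [h])
    (by simpa [h] using (modelCurve_subset_cornerTriangle hz).2.2)

lemma eq_one_of_im_eq_zero (hz : z ∈ modelCurve) (h : z.im = 0) : z = 1 :=
  eq_of_re_le_of_im_le hz one_mem_modelCurve
    (by simpa [h] using (modelCurve_subset_cornerTriangle hz).2.2) (by simp [h])

lemma eq_one_of_smul_mem_modelCurve {s : ℝ} (hz : z ∈ modelCurve) (hs : s • z ∈ modelCurve) :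
    s = 1 := by
  obtain ⟨hre, him, -⟩ := modelCurve_subset_cornerTriangle hz
  have hz0 : z ≠ 0 := fun h => zero_notMem_modelCurve (h ▸ hz)
  have hsz : s • z = z := by
    rcases le_total s 1 with h | h
    · exact eq_of_re_le_of_im_le hs hz (by simpa using mul_le_of_le_one_left hre h)
        (by simpa using mul_le_of_le_one_left him h)
    · exact (eq_of_re_le_of_im_le hz hs (by simpa using le_mul_of_one_le_left hre h)
        (by simpa using le_mul_of_one_le_left him h)).symm
  exact smul_left_injective ℝ hz0 (by simpa using hsz)

lemma exists_mem_modelCurve_re_eq {t : ℝ} (h0 : 0 ≤ t) (h1 : t ≤ 1) :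
    ∃ k ∈ modelCurve, k.re = t :=
  isPreconnected_modelCurve.intermediate_value I_mem_modelCurve one_mem_modelCurve
    Complex.continuous_re.continuousOn (by simpa using ⟨h0, h1⟩)

lemma exists_mem_modelCurve_im_eq {t : ℝ} (h0 : 0 ≤ t) (h1 : t ≤ 1) :
    ∃ k ∈ modelCurve, k.im = t :=
  isPreconnected_modelCurve.intermediate_value one_mem_modelCurve I_mem_modelCurve
    Complex.continuous_im.continuousOn (by simpa using ⟨h0, h1⟩)

lemma exists_smul_mem_modelCurve (hre : 0 ≤ z.re) (him : 0 ≤ z.im) (hz : z ≠ 0) :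
    ∃ s : ℝ, 0 < s ∧ s • z ∈ modelCurve := by
  obtain ⟨k, hk, hdir⟩ : ∃ k ∈ modelCurve, ω z k = 0 :=
    isPreconnected_modelCurve.intermediate_value one_mem_modelCurve I_mem_modelCurve
      (f := fun k => ω z k) (by simp only [areaForm_eq]; fun_prop)
      (by simpa [areaForm_eq] using ⟨him, hre⟩)
  rw [areaForm_eq] at hdir
  have hsum : 0 < z.re + z.im := by
    refine (add_nonneg hre him).lt_of_ne' fun h => hz (Complex.ext ?_ ?_) <;>
      simp only [Complex.zero_re, Complex.zero_im] <;> linarith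
  have hk_sum := two_thirds_le_re_add_im hk
  refine ⟨(k.re + k.im) / (z.re + z.im), by positivity, ?_⟩
  convert hk using 1
  apply Complex.ext <;> simp only [Complex.smul_re, Complex.smul_im, smul_eq_mul] <;>
    field_simp <;> linarith

end ModelCurve

/-! ### The region below the model curve -/

/-- The region between the model curve and the coordinate axes. -/
def modelRegion : Set ℂ :=
  {z | 0 ≤ z.re ∧ 0 ≤ z.im ∧ ∃ k ∈ modelCurve, z.re ≤ k.re ∧ z.im ≤ k.im}

section ModelRegion

variable {z : ℂ}

lemma modelRegion_subset_cornerTriangle : modelRegion ⊆ cornerTriangle := by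
  rintro z ⟨hre, him, k, hk, hkre, hkim⟩
  exact ⟨hre, him, (add_le_add hkre hkim).trans (modelCurve_subset_cornerTriangle hk).2.2⟩

lemma exists_im_eq_of_mem_modelRegion (hz : z ∈ modelRegion) :
    ∃ k ∈ modelCurve, k.im = z.im ∧ z.re ≤ k.re := by
  obtain ⟨-, him, l, hl, hlre, hlim⟩ := hz
  obtain ⟨hl0, -, hl1⟩ := modelCurve_subset_cornerTriangle hl
  obtain ⟨k, hk, hkim⟩ := exists_mem_modelCurve_im_eq him (by linarith)
  refine ⟨k, hk, hkim, ?_⟩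
  by_contra! hlt
  exact hlt.not_ge (eq_of_re_le_of_im_le hk hl (hlt.le.trans hlre) (hkim.trans_le hlim) ▸ hlre)

lemma exists_re_eq_of_mem_modelRegion (hz : z ∈ modelRegion) :
    ∃ k ∈ modelCurve, k.re = z.re ∧ z.im ≤ k.im := by
  obtain ⟨hre, -, l, hl, hlre, hlim⟩ := hz
  obtain ⟨-, hl0, hl1⟩ := modelCurve_subset_cornerTriangle hl
  obtain ⟨k, hk, hkre⟩ := exists_mem_modelCurve_re_eq hre (by linarith)
  refine ⟨k, hk, hkre, ?_⟩
  by_contra! hlt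
  exact hlt.not_ge (eq_of_re_le_of_im_le hk hl (hkre.trans_le hlre) (hlt.le.trans hlim) ▸ hlim)

lemma modelRegion_eq_smul : modelRegion = Icc (0 : ℝ) 1 • modelCurve := by
  ext z
  constructor
  · rintro ⟨hre, him, k, hk, hkre, hkim⟩
    rcases eq_or_ne z 0 with rfl | hz
    · exact ⟨0, by simp, k, hk, by simp⟩
    obtain ⟨s, hs, hsz⟩ := exists_smul_mem_modelCurve hre him hz
    have one_le : 1 ≤ s := by
      by_contra! hlt
      have hsk : s • z = k := eq_of_re_le_of_im_le hsz hk
        (by simpa using (mul_le_of_le_one_left hre hlt.le).trans hkre)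
        (by simpa using (mul_le_of_le_one_left him hlt.le).trans hkim)
      rw [← hsk, Complex.smul_re, smul_eq_mul] at hkre
      rw [← hsk, Complex.smul_im, smul_eq_mul] at hkim
      exact hz (Complex.ext (by rw [Complex.zero_re]; nlinarith)
        (by rw [Complex.zero_im]; nlinarith))
    exact ⟨s⁻¹, ⟨by positivity, inv_le_one_of_one_le₀ one_le⟩, s • z, hsz, inv_smul_smul₀ hs.ne' z⟩
  · rintro ⟨t, ⟨ht0, ht1⟩, k, hk, rfl⟩
    obtain ⟨hre, him, -⟩ := modelCurve_subset_cornerTriangle hk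
    simp only [modelRegion, mem_ofPred_eq, Complex.smul_re, Complex.smul_im, smul_eq_mul]
    exact ⟨by positivity, by positivity, k, hk, mul_le_of_le_one_left hre ht1,
      mul_le_of_le_one_left him ht1⟩

lemma isCompact_modelRegion : IsCompact modelRegion :=
  modelRegion_eq_smul ▸ isCompact_Icc.smul_set isCompact_modelCurve

lemma mapsTo_cutLeft_modelRegion : MapsTo cutLeft modelRegion modelRegion := by
  intro z hz
  obtain ⟨hre, him, hsum⟩ := modelRegion_subset_cornerTriangle hz
  obtain ⟨k, hk, hkim, hkre⟩ := exists_im_eq_of_mem_modelRegion hz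
  refine ⟨?_, ?_, cutLeft k, mapsTo_cutLeft_modelCurve hk, ?_, ?_⟩ <;>
    simp only [cutLeft_re, cutLeft_im] <;> linarith

lemma mapsTo_cutRight_modelRegion : MapsTo cutRight modelRegion modelRegion := by
  intro z hz
  obtain ⟨hre, him, hsum⟩ := modelRegion_subset_cornerTriangle hz
  obtain ⟨k, hk, hkre, hkim⟩ := exists_re_eq_of_mem_modelRegion hz
  refine ⟨?_, ?_, cutRight k, mapsTo_cutRight_modelCurve hk, ?_, ?_⟩ <;>
    simp only [cutRight_re, cutRight_im] <;> linarith

lemma mem_two_thirds_smul_cornerTriangle :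
    z ∈ (2 / 3 : ℝ) • cornerTriangle ↔ 0 ≤ z.re ∧ 0 ≤ z.im ∧ z.re + z.im ≤ 2 / 3 := by
  rw [mem_smul_set_iff_inv_smul_mem₀ (by norm_num)]
  simp only [cornerTriangle, mem_ofPred_eq, Complex.smul_re, Complex.smul_im, smul_eq_mul]
  constructor <;> rintro ⟨hre, him, hsum⟩ <;> refine ⟨?_, ?_, ?_⟩ <;> linarith

lemma two_thirds_smul_cornerTriangle_subset : (2 / 3 : ℝ) • cornerTriangle ⊆ modelRegion := by
  intro z hz
  obtain ⟨hre, him, hsum⟩ := mem_two_thirds_smul_cornerTriangle.mp hz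
  obtain ⟨k, hk, hkre⟩ := exists_mem_modelCurve_re_eq hre (by linarith)
  exact ⟨hre, him, k, hk, hkre.ge, by linarith [two_thirds_le_re_add_im hk]⟩

lemma mem_cutLeft_image_modelRegion {k : ℂ} (him : 0 ≤ z.im) (hsum : 2 / 3 ≤ z.re + z.im)
    (hk : k ∈ modelCurve) (hkim : (cutLeft k).im = z.im) (hkre : z.re ≤ (cutLeft k).re) :
    z ∈ cutLeft '' modelRegion := by
  rw [cutLeft_im] at hkim
  rw [cutLeft_re] at hkre
  refine ⟨⟨3 * (z.re + z.im) - 2, 3 * z.im⟩, ⟨?_, ?_, k, hk, ?_, ?_⟩, ?_⟩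
  · linarith
  · linarith
  · linarith
  · linarith
  · apply Complex.ext <;> simp; ring

lemma mem_cutRight_image_modelRegion {k : ℂ} (hre : 0 ≤ z.re) (hsum : 2 / 3 ≤ z.re + z.im)
    (hk : k ∈ modelCurve) (hkre : (cutRight k).re = z.re) (hkim : z.im ≤ (cutRight k).im) :
    z ∈ cutRight '' modelRegion := by
  rw [cutRight_re] at hkre
  rw [cutRight_im] at hkim
  refine ⟨⟨3 * z.re, 3 * (z.re + z.im) - 2⟩, ⟨?_, ?_, k, hk, ?_, ?_⟩, ?_⟩
  · linarith
  · linarith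
  · linarith
  · linarith
  · apply Complex.ext <;> simp; ring

lemma modelRegion_eq_union : modelRegion =
    (2 / 3 : ℝ) • cornerTriangle ∪ (cutLeft '' modelRegion ∪ cutRight '' modelRegion) := by
  refine subset_antisymm (fun z hz => ?_) (union_subset two_thirds_smul_cornerTriangle_subset
    (union_subset mapsTo_cutLeft_modelRegion.image_subset
      mapsTo_cutRight_modelRegion.image_subset))
  obtain ⟨hre, him, -⟩ := id hz
  rcases le_total (z.re + z.im) (2 / 3) with hsum | hsum
  · exact Or.inl (mem_two_thirds_smul_cornerTriangle.mpr ⟨hre, him, hsum⟩)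
  obtain ⟨k, hk, hkim, hkre⟩ := exists_im_eq_of_mem_modelRegion hz
  obtain ⟨l, hl, hlre, hlim⟩ := exists_re_eq_of_mem_modelRegion hz
  obtain ⟨k', hk', rfl⟩ | ⟨k', hk', rfl⟩ := modelCurve_eq_union.subset hk
  · exact Or.inr (Or.inl (mem_cutLeft_image_modelRegion him hsum hk' hkim hkre))
  obtain ⟨l', hl', rfl⟩ | ⟨l', hl', rfl⟩ := modelCurve_eq_union.subset hl
  · obtain ⟨hk0, hk1, hk2⟩ := modelCurve_subset_cornerTriangle hk'
    obtain ⟨hl0, hl1, hl2⟩ := modelCurve_subset_cornerTriangle hl'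
    rw [cutRight_re] at hkre
    rw [cutLeft_im] at hlim
    exact Or.inl (mem_two_thirds_smul_cornerTriangle.mpr ⟨hre, him, by linarith⟩)
  · exact Or.inr (Or.inr (mem_cutRight_image_modelRegion hre hsum hl' hlre hlim))

end ModelRegion

lemma volume_setOf_re_eq_zero : volume {z : ℂ | z.re = 0} = 0 := by
  have hsub : {z : ℂ | z.re = 0} ⊆ frame 0 0 I '' univ := fun z hz =>
    ⟨z, mem_univ z, Complex.ext (by simpa [frame_apply] using Eq.symm hz) (by simp [frame_apply])⟩
  exact measure_mono_null hsub (by rw [volume_frame_image]; simp)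

lemma volume_setOf_im_eq_zero : volume {z : ℂ | z.im = 0} = 0 := by
  have hsub : {z : ℂ | z.im = 0} ⊆ frame 0 1 0 '' univ := fun z hz =>
    ⟨z, mem_univ z, Complex.ext (by simp [frame_apply]) (by simpa [frame_apply] using Eq.symm hz)⟩
  exact measure_mono_null hsub (by rw [volume_frame_image]; simp)

lemma volume_cutLeft_image (s : Set ℂ) : volume (cutLeft '' s) = 9⁻¹ * volume s := by
  have harea : |ω (1 / 3) ((I - 1) / 3)| = 9⁻¹ := by rw [areaForm_eq]; norm_num
  rw [cutLeft, volume_frame_image, harea, ENNReal.ofReal_inv_of_pos (by norm_num),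
    ENNReal.ofReal_ofNat]

lemma volume_cutRight_image (s : Set ℂ) : volume (cutRight '' s) = 9⁻¹ * volume s := by
  have harea : |ω ((1 - I) / 3) (I / 3)| = 9⁻¹ := by rw [areaForm_eq]; norm_num
  rw [cutRight, volume_frame_image, harea, ENNReal.ofReal_inv_of_pos (by norm_num),
    ENNReal.ofReal_ofNat]

lemma volume_modelCurve : volume modelCurve = 0 := by
  have hle : volume modelCurve ≤ 9⁻¹ * volume modelCurve + 9⁻¹ * volume modelCurve := by
    calc volume modelCurve
        ≤ volume (cutLeft '' modelCurve) + volume (cutRight '' modelCurve) :=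
          (measure_mono modelCurve_eq_union.subset).trans (measure_union_le _ _)
      _ = _ := by rw [volume_cutLeft_image, volume_cutRight_image]
  have hfin := isCompact_modelCurve.measure_ne_top (μ := volume)
  rw [← ENNReal.toReal_le_toReal hfin (by finiteness), ENNReal.toReal_add (by finiteness)
    (by finiteness), ENNReal.toReal_mul] at hle
  norm_num at hle
  have h0 : 0 ≤ (volume modelCurve).toReal := ENNReal.toReal_nonneg
  exact ((ENNReal.toReal_eq_zero_iff _).mp (by linarith)).resolve_right hfin

lemma aedisjoint_cutLeft_cutRight :
    AEDisjoint volume (cutLeft '' modelRegion) (cutRight '' modelRegion) := by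
  refine measure_mono_null ?_ (measure_singleton (cutLeft I))
  rintro _ ⟨⟨z, hz, rfl⟩, w, hw, hzw⟩
  obtain ⟨rfl, -⟩ := eq_of_cutLeft_re_le_cutRight_re (modelRegion_subset_cornerTriangle hz)
    (modelRegion_subset_cornerTriangle hw) (congrArg Complex.re hzw).ge
  rfl

lemma aedisjoint_two_thirds_smul_cuts :
    AEDisjoint volume ((2 / 3 : ℝ) • cornerTriangle)
      (cutLeft '' modelRegion ∪ cutRight '' modelRegion) := by
  refine AEDisjoint.union_right_iff.mpr ⟨?_, ?_⟩
  · refine measure_mono_null (t := cutLeft '' {z | z.re = 0}) ?_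
      (by rw [volume_cutLeft_image, volume_setOf_re_eq_zero, mul_zero])
    rintro _ ⟨hcut, w, hw, rfl⟩
    have hsum := (mem_two_thirds_smul_cornerTriangle.mp hcut).2.2
    rw [cutLeft_re, cutLeft_im] at hsum
    exact mem_image_of_mem _ (le_antisymm (by linarith) hw.1)
  · refine measure_mono_null (t := cutRight '' {z | z.im = 0}) ?_
      (by rw [volume_cutRight_image, volume_setOf_im_eq_zero, mul_zero])
    rintro _ ⟨hcut, w, hw, rfl⟩
    have hsum := (mem_two_thirds_smul_cornerTriangle.mp hcut).2.2
    rw [cutRight_re, cutRight_im] at hsum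
    exact mem_image_of_mem _ (le_antisymm (by linarith) hw.2.1)

lemma volume_modelRegion : volume modelRegion = 4 / 7 * volume cornerTriangle := by
  have hL := isCompact_modelRegion.image lipschitzWith_cutLeft.continuous
  have hR := isCompact_modelRegion.image lipschitzWith_cutRight.continuous
  have hself : volume modelRegion = ENNReal.ofReal (4 / 9) * volume cornerTriangle +
      (9⁻¹ * volume modelRegion + 9⁻¹ * volume modelRegion) := by
    conv_lhs => rw [modelRegion_eq_union]
    rw [measure_union₀ (hL.union hR).measurableSet.nullMeasurableSet
      aedisjoint_two_thirds_smul_cuts,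
      measure_union₀ hR.measurableSet.nullMeasurableSet aedisjoint_cutLeft_cutRight,
      volume_cutLeft_image, volume_cutRight_image, Measure.addHaar_smul,
      Complex.finrank_real_complex]
    norm_num
  have hD := isCompact_modelRegion.measure_ne_top (μ := volume)
  have hΔ := isCompact_cornerTriangle.measure_ne_top (μ := volume)
  rw [← ENNReal.toReal_eq_toReal_iff' hD (by finiteness), ENNReal.toReal_add (by finiteness)
    (by finiteness), ENNReal.toReal_add (by finiteness) (by finiteness)] at hself
  rw [← ENNReal.toReal_eq_toReal_iff' hD (by finiteness)]
  norm_num at hself ⊢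
  linarith

/-! ### Regions enclosed by star-shaped curves -/

section StarShaped

variable {E : Type*} [NormedAddCommGroup E] [NormedSpace ℝ E] {K : Set E} {z : E}

lemma not_isBounded_image_smul_Ici (hz : z ≠ 0) (a : ℝ) :
    ¬ Bornology.IsBounded ((· • z) '' Ici a) := by
  intro hbdd
  obtain ⟨R, hR⟩ := hbdd.exists_norm_le
  have hle := hR _ (mem_image_of_mem _ (le_max_left a ((|R| + 1) / ‖z‖)))
  have hpos : 0 < ‖z‖ := norm_pos_iff.mpr hz
  have hge : |R| + 1 ≤ ‖max a ((|R| + 1) / ‖z‖) • z‖ := by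
    rw [norm_smul, ← div_le_iff₀ hpos]
    exact (le_max_right a _).trans (le_abs_self _)
  linarith [le_abs_self R]

lemma not_isBounded_connectedComponentIn_compl (hz : z ≠ 0) (hzK : z ∉ Icc (0 : ℝ) 1 • K) :
    ¬ Bornology.IsBounded (connectedComponentIn Kᶜ z) := by
  refine fun hbdd => not_isBounded_image_smul_Ici hz 1 (hbdd.subset ?_)
  refine (isPreconnected_Ici.image _ (by fun_prop)).subset_connectedComponentIn
    ⟨1, self_mem_Ici, one_smul ℝ z⟩ ?_
  rintro _ ⟨s, hs : 1 ≤ s, rfl⟩ hsK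
  exact hzK ⟨s⁻¹, ⟨by positivity, inv_le_one_of_one_le₀ hs⟩, s • z, hsK,
    inv_smul_smul₀ (by positivity) z⟩

/-- The set of points that lie behind `K` as seen from the origin. -/
def shadow (K : Set E) : Set E := {w | ∃ t ∈ Icc (0 : ℝ) 1, t • w ∈ K}

lemma isClosed_shadow (hK : IsClosed K) : IsClosed (shadow K) := by
  have h := isClosedMap_snd_of_compactSpace (X := Icc (0 : ℝ) 1) (Y := E)
    {p | (p.1 : ℝ) • p.2 ∈ K} (hK.preimage (by fun_prop))
  convert h using 1
  ext z
  simp [shadow]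

lemma smul_union_shadow_eq_univ (hK : K.Nonempty)
    (hray : ∀ w : E, w ≠ 0 → ∃ s : ℝ, 0 < s ∧ s • w ∈ K) :
    Icc (0 : ℝ) 1 • K ∪ shadow K = univ := by
  refine eq_univ_of_forall fun w => ?_
  rcases eq_or_ne w 0 with rfl | hw
  · exact Or.inl ⟨0, by simp, hK.some, hK.some_mem, by simp⟩
  obtain ⟨s, hs, hsw⟩ := hray w hw
  rcases le_total s 1 with h | h
  · exact Or.inr ⟨s, ⟨hs.le, h⟩, hsw⟩
  · exact Or.inl ⟨s⁻¹, ⟨by positivity, inv_le_one_of_one_le₀ h⟩, s • w, hsw,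
      inv_smul_smul₀ hs.ne' w⟩

lemma smul_inter_shadow_subset (h0 : (0 : E) ∉ K)
    (hray : ∀ k ∈ K, ∀ s : ℝ, 0 < s → s • k ∈ K → s = 1) :
    Icc (0 : ℝ) 1 • K ∩ shadow K ⊆ K := by
  rintro _ ⟨⟨s, ⟨hs0, hs1⟩, k, hk, rfl⟩, t, ⟨ht0, ht1⟩, htk⟩
  have hts : t * s ≠ 0 := fun h => h0 (by simpa [smul_smul, h] using htk)
  have heq : t * s = 1 :=
    hray k hk _ ((mul_nonneg ht0 hs0).lt_of_ne' hts) (by simpa only [mul_smul] using htk)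
  have hs : s = 1 := le_antisymm hs1 (by nlinarith)
  simpa [hs] using hk

lemma connectedComponentIn_compl_subset_smul (hK : IsCompact K) (h0 : (0 : E) ∉ K)
    (hexists : ∀ w : E, w ≠ 0 → ∃ s : ℝ, 0 < s ∧ s • w ∈ K)
    (hunique : ∀ k ∈ K, ∀ s : ℝ, 0 < s → s • k ∈ K → s = 1) (hz : z ∈ Icc (0 : ℝ) 1 • K)
    (hzK : z ∉ K) : connectedComponentIn Kᶜ z ⊆ Icc (0 : ℝ) 1 • K := by
  have hcover := smul_union_shadow_eq_univ (nonempty_of_mem hz).of_smul_right hexists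
  have hinter := smul_inter_shadow_subset h0 hunique
  have hclosed : IsClosed (Icc (0 : ℝ) 1 • K) := (isCompact_Icc.smul_set hK).isClosed
  have hsub : connectedComponentIn Kᶜ z ⊆ (shadow K)ᶜ := by
    refine isPreconnected_connectedComponentIn.subset_left_of_subset_union
      (isClosed_shadow hK.isClosed).isOpen_compl hclosed.isOpen_compl ?_ ?_
      ⟨z, mem_connectedComponentIn hzK, fun h => hzK (hinter ⟨hz, h⟩)⟩
    · exact disjoint_compl_left_iff_subset.mpr (compl_subset_iff_union.mpr hcover)
    · rw [← compl_inter, inter_comm]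
      exact (connectedComponentIn_subset _ _).trans (compl_subset_compl.mpr hinter)
  exact hsub.trans (compl_subset_iff_union.mpr (union_comm _ _ ▸ hcover))

end StarShaped

lemma enclosedRegion_eq_smul_diff {K : Set ℂ} (hK : IsCompact K) (h0 : (0 : ℂ) ∉ K)
    (hexists : ∀ w : ℂ, w ≠ 0 → ∃ s : ℝ, 0 < s ∧ s • w ∈ K)
    (hunique : ∀ k ∈ K, ∀ s : ℝ, 0 < s → s • k ∈ K → s = 1) :
    enclosedRegion K = Icc (0 : ℝ) 1 • K \ K := by
  ext z
  constructor
  · rintro ⟨hzK, hbdd⟩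
    refine ⟨?_, hzK⟩
    rcases eq_or_ne z 0 with rfl | hz
    · obtain ⟨s, -, hs⟩ := hexists 1 one_ne_zero
      exact ⟨0, by simp, s • 1, hs, by simp⟩
    · by_contra hzR
      exact not_isBounded_connectedComponentIn_compl hz hzR hbdd
  · rintro ⟨hz, hzK⟩
    exact ⟨hzK, (isCompact_Icc.smul_set hK).isBounded.subset
      (connectedComponentIn_compl_subset_smul hK h0 hexists hunique hz hzK)⟩

lemma image_enclosedRegion (e : ℂ ≃ₜ ℂ) (K : Set ℂ) :
    e '' enclosedRegion K = enclosedRegion (e '' K) := by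
  have isBounded_image (f : ℂ ≃ₜ ℂ) {s : Set ℂ} (hs : Bornology.IsBounded s) :
      Bornology.IsBounded (f '' s) :=
    (hs.isCompact_closure.image f.continuous).isBounded.subset (image_mono subset_closure)
  ext w
  obtain ⟨z, rfl⟩ := e.surjective w
  rw [e.injective.mem_set_image]
  simp only [enclosedRegion, mem_ofPred_eq, e.injective.mem_set_image, ← image_compl_eq e.bijective]
  refine and_congr_right fun hz => ?_
  rw [← e.image_connectedComponentIn hz]
  exact ⟨isBounded_image e, fun h => by simpa [image_image] using isBounded_image e.symm h⟩

lemma enclosedRegion_singleton (p : ℂ) : enclosedRegion {p} = ∅ := by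
  have h0 : enclosedRegion {0} = ∅ := eq_empty_of_forall_notMem fun z hz =>
    not_isBounded_connectedComponentIn_compl hz.1 (by simpa using hz.1) hz.2
  simpa [h0] using (image_enclosedRegion (Homeomorph.addLeft p) {0}).symm

/-! ### The model triangle -/

/-- The linear map of order three that permutes `1`, `I`, `-1 - I` cyclically. -/
noncomputable def cyc : ℂ →ᵃ[ℝ] ℂ := frame 0 I (-1 - I)

/-- The closed curve that consists of the three images of the model curve under the powers of
`cyc`; the boundary of every proper Apollonian triangle is an affine image of it. -/
def modelBoundary : Set ℂ := modelCurve ∪ cyc '' modelCurve ∪ cyc '' (cyc '' modelCurve)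

section ModelBoundary

variable {z : ℂ} {s : ℝ}

@[simp] lemma cyc_re (z : ℂ) : (cyc z).re = -z.im := by simp [cyc, frame_apply]

@[simp] lemma cyc_im (z : ℂ) : (cyc z).im = z.re - z.im := by
  simp [cyc, frame_apply, sub_eq_add_neg]

lemma cyc_smul (s : ℝ) (z : ℂ) : cyc (s • z) = s • cyc z := frame_smul s z

lemma cyc_cyc_cyc (z : ℂ) : cyc (cyc (cyc z)) = z := by
  apply Complex.ext <;> simp only [cyc_re, cyc_im] <;> ring

lemma mem_cyc_image {A : Set ℂ} : z ∈ cyc '' A ↔ cyc (cyc z) ∈ A :=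
  ⟨by rintro ⟨w, hw, rfl⟩; rwa [cyc_cyc_cyc], fun h => ⟨_, h, cyc_cyc_cyc z⟩⟩

lemma mem_modelBoundary :
    z ∈ modelBoundary ↔ z ∈ modelCurve ∨ cyc z ∈ modelCurve ∨ cyc (cyc z) ∈ modelCurve := by
  simp only [modelBoundary, mem_union, mem_cyc_image, cyc_cyc_cyc]
  tauto

lemma cyc_mem_modelBoundary (hz : z ∈ modelBoundary) : cyc z ∈ modelBoundary := by
  rw [mem_modelBoundary] at hz ⊢
  rw [cyc_cyc_cyc]
  tauto

lemma isCompact_modelBoundary : IsCompact modelBoundary :=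
  have himage {A : Set ℂ} (hA : IsCompact A) : IsCompact (cyc '' A) :=
    hA.image (continuous_frame _ _ _)
  (isCompact_modelCurve.union (himage isCompact_modelCurve)).union
    (himage (himage isCompact_modelCurve))

lemma zero_notMem_modelBoundary : (0 : ℂ) ∉ modelBoundary := by
  simp [mem_modelBoundary, cyc, zero_notMem_modelCurve]

lemma exists_smul_mem_modelBoundary (hz : z ≠ 0) : ∃ s : ℝ, 0 < s ∧ s • z ∈ modelBoundary := by
  have hcyc {w : ℂ} (hw : w ≠ 0) : cyc w ≠ 0 := fun h =>
    hw (by rw [← cyc_cyc_cyc w, h]; simp [cyc])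
  simp only [mem_modelBoundary]
  have hsectors : (0 ≤ z.re ∧ 0 ≤ z.im) ∨ (0 ≤ (cyc z).re ∧ 0 ≤ (cyc z).im) ∨
      (0 ≤ (cyc (cyc z)).re ∧ 0 ≤ (cyc (cyc z)).im) := by
    simp only [cyc_re, cyc_im]
    grind
  obtain ⟨hre, him⟩ | ⟨hre, him⟩ | ⟨hre, him⟩ := hsectors
  · obtain ⟨s, hs, h⟩ := exists_smul_mem_modelCurve hre him hz
    exact ⟨s, hs, Or.inl h⟩
  · obtain ⟨s, hs, h⟩ := exists_smul_mem_modelCurve hre him (hcyc hz)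
    exact ⟨s, hs, Or.inr (Or.inl (by rwa [cyc_smul]))⟩
  · obtain ⟨s, hs, h⟩ := exists_smul_mem_modelCurve hre him (hcyc (hcyc hz))
    exact ⟨s, hs, Or.inr (Or.inr (by rwa [cyc_smul, cyc_smul]))⟩

lemma eq_one_of_smul_mem_modelBoundary_of_mem_modelCurve (hs0 : 0 < s) (hz : z ∈ modelCurve)
    (hs : s • z ∈ modelBoundary) : s = 1 := by
  obtain ⟨hre, him, -⟩ := modelCurve_subset_cornerTriangle hz
  rw [mem_modelBoundary, cyc_smul, cyc_smul] at hs
  obtain h | h | h := hs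
  · exact eq_one_of_smul_mem_modelCurve hz h
  · have him0 : z.im = 0 := by
      have hle := (modelCurve_subset_cornerTriangle h).1
      rw [Complex.smul_re, cyc_re, smul_eq_mul] at hle
      nlinarith
    rw [eq_one_of_im_eq_zero hz him0] at h
    simpa [Complex.ext_iff] using eq_I_of_re_eq_zero h (by simp)
  · have hre0 : z.re = 0 := by
      have hle := (modelCurve_subset_cornerTriangle h).2.1
      rw [Complex.smul_im, cyc_im, cyc_re, cyc_im, smul_eq_mul] at hle
      nlinarith
    rw [eq_I_of_re_eq_zero hz hre0] at h
    simpa [Complex.ext_iff] using eq_one_of_im_eq_zero h (by simp)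

lemma eq_one_of_smul_mem_modelBoundary (hs0 : 0 < s) (hz : z ∈ modelBoundary)
    (hs : s • z ∈ modelBoundary) : s = 1 := by
  obtain h | h | h := mem_modelBoundary.mp hz
  · exact eq_one_of_smul_mem_modelBoundary_of_mem_modelCurve hs0 h hs
  · exact eq_one_of_smul_mem_modelBoundary_of_mem_modelCurve hs0 h
      (cyc_smul s z ▸ cyc_mem_modelBoundary hs)
  · refine eq_one_of_smul_mem_modelBoundary_of_mem_modelCurve hs0 h ?_
    rw [← cyc_smul, ← cyc_smul]
    exact cyc_mem_modelBoundary (cyc_mem_modelBoundary hs)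

lemma smul_cyc_image (A : Set ℂ) : Icc (0 : ℝ) 1 • cyc '' A = cyc '' (Icc (0 : ℝ) 1 • A) :=
  (image_image2_distrib_right cyc_smul).symm

lemma enclosedRegion_modelBoundary : enclosedRegion modelBoundary =
    (modelRegion ∪ cyc '' modelRegion ∪ cyc '' (cyc '' modelRegion)) \ modelBoundary := by
  rw [enclosedRegion_eq_smul_diff isCompact_modelBoundary zero_notMem_modelBoundary
    (fun _ => exists_smul_mem_modelBoundary)
    (fun _ hz _ hs0 hs => eq_one_of_smul_mem_modelBoundary hs0 hz hs)]
  nth_rw 1 [modelBoundary]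
  rw [smul_union, smul_union, smul_cyc_image, smul_cyc_image, smul_cyc_image, modelRegion_eq_smul]

lemma volume_cyc_image (A : Set ℂ) : volume (cyc '' A) = volume A := by
  rw [cyc, volume_frame_image, areaForm_eq]
  simp

lemma volume_modelBoundary : volume modelBoundary = 0 := by
  simp [modelBoundary, volume_cyc_image, volume_modelCurve]

lemma aedisjoint_modelRegion_cyc_image : AEDisjoint volume modelRegion (cyc '' modelRegion) := by
  refine measure_mono_null ?_ volume_setOf_re_eq_zero
  rintro _ ⟨hz, w, hw, rfl⟩
  have hz0 := (modelRegion_subset_cornerTriangle hz).1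
  have hw0 := (modelRegion_subset_cornerTriangle hw).2.1
  rw [cyc_re] at hz0
  rw [mem_ofPred_eq, cyc_re]
  linarith

lemma aedisjoint_modelRegion_cyc_cyc_image :
    AEDisjoint volume modelRegion (cyc '' (cyc '' modelRegion)) := by
  refine measure_mono_null ?_ volume_setOf_im_eq_zero
  rintro _ ⟨hz, _, ⟨w, hw, rfl⟩, rfl⟩
  have hz0 := (modelRegion_subset_cornerTriangle hz).2.1
  have hw0 := (modelRegion_subset_cornerTriangle hw).1
  rw [cyc_im, cyc_re, cyc_im] at hz0
  rw [mem_ofPred_eq, cyc_im, cyc_re, cyc_im]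
  linarith

lemma volume_enclosedRegion_modelBoundary :
    volume (enclosedRegion modelBoundary) = 3 * volume modelRegion := by
  have hcompact : IsCompact (cyc '' modelRegion) :=
    isCompact_modelRegion.image (continuous_frame _ _ _)
  have hcompact' : IsCompact (cyc '' (cyc '' modelRegion)) :=
    hcompact.image (continuous_frame _ _ _)
  have hinjective : Function.Injective cyc :=
    Function.LeftInverse.injective (g := fun z => cyc (cyc z)) cyc_cyc_cyc
  have hdisjoint : AEDisjoint volume (cyc '' modelRegion) (cyc '' (cyc '' modelRegion)) := by
    rw [AEDisjoint, ← image_inter hinjective, volume_cyc_image]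
    exact aedisjoint_modelRegion_cyc_image
  rw [enclosedRegion_modelBoundary, measure_sdiff_null volume_modelBoundary,
    measure_union₀ hcompact'.measurableSet.nullMeasurableSet
      (aedisjoint_modelRegion_cyc_cyc_image.union_left hdisjoint),
    measure_union₀ hcompact.measurableSet.nullMeasurableSet aedisjoint_modelRegion_cyc_image,
    volume_cyc_image, volume_cyc_image, volume_cyc_image]
  ring

lemma convex_cornerTriangle : Convex ℝ cornerTriangle := by
  have hsplit : cornerTriangle = Complex.reLm ⁻¹' Ici 0 ∩ Complex.imLm ⁻¹' Ici 0 ∩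
      (Complex.reLm + Complex.imLm) ⁻¹' Iic 1 := by
    ext z; simp [cornerTriangle, and_assoc]
  rw [hsplit]
  exact (((convex_Ici 0).linear_preimage _).inter ((convex_Ici 0).linear_preimage _)).inter
    ((convex_Iic 1).linear_preimage _)

lemma convexHull_zero_one_I : convexHull ℝ {0, 1, I} = cornerTriangle := by
  refine (convexHull_min ?_ convex_cornerTriangle).antisymm fun z ⟨hre, him, hsum⟩ => ?_
  · rintro z (rfl | rfl | rfl) <;> simp [cornerTriangle]
  · have hmem {w : ℂ} (hw : w ∈ ({0, 1, I} : Set ℂ)) : w ∈ convexHull ℝ {0, 1, I} :=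
      subset_convexHull ℝ _ hw
    have hz : z = ∑ i, ![1 - z.re - z.im, z.re, z.im] i • ![0, 1, I] i := by
      apply Complex.ext <;> simp [Fin.sum_univ_three]
    rw [hz]
    refine (convex_convexHull ℝ _).sum_mem (fun i _ => ?_) ?_ fun i _ => ?_
    · fin_cases i
      exacts [by simpa using (by linarith : z.im ≤ 1 - z.re), hre, him]
    · simp only [Fin.sum_univ_three, Matrix.cons_val]
      ring
    · fin_cases i <;> exact hmem (by simp)

lemma volume_convexHull_triple (p q r : ℂ) : volume (convexHull ℝ {p, q, r}) =
    ENNReal.ofReal |ω (q - p) (r - p)| * volume cornerTriangle := by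
  rw [← volume_frame_image p, ← convexHull_zero_one_I, AffineMap.image_convexHull]
  simp [image_insert_eq]

end ModelBoundary

lemma volume_enclosedRegion_frame_image {o x y : ℂ} (h : ω x y ≠ 0 ∨ x = 0 ∧ y = 0) :
    volume (enclosedRegion (frame o x y '' modelBoundary)) =
      4 / 7 * volume (convexHull ℝ {o + x, o + y, o - x - y}) := by
  obtain h | ⟨rfl, rfl⟩ := h
  · obtain ⟨e, he⟩ := exists_homeomorph_eq_frame (o := o) h
    have harea : ω (o + y - (o + x)) (o - x - y - (o + x)) = 3 * ω x y := by
      simp only [areaForm_eq, Complex.sub_re, Complex.sub_im, Complex.add_re, Complex.add_im]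
      ring
    rw [← he, ← image_enclosedRegion, he, volume_frame_image, volume_enclosedRegion_modelBoundary,
      volume_modelRegion, volume_convexHull_triple, harea, abs_mul,
      ENNReal.ofReal_mul (abs_nonneg 3), abs_of_pos (three_pos (α := ℝ)), ENNReal.ofReal_ofNat]
    ring
  · have hconst : frame o 0 0 '' modelBoundary = {o} := by
      have hne : modelBoundary.Nonempty := ⟨1, mem_modelBoundary.mpr (Or.inl one_mem_modelCurve)⟩
      simpa [image_congr fun z _ => frame_apply o 0 0 z] using hne.image_const o
    simp [hconst, enclosedRegion_singleton]

/-! ### Half angles -/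

/-- The unit vector whose angle with the positive real axis is half of `t`. -/
noncomputable def halfDir (t : ℝ) : ℂ := Complex.exp ((t / 2 : ℝ) * I)

section HalfDir

variable {u v : ℂ} {s t : ℝ}

lemma norm_halfDir (t : ℝ) : ‖halfDir t‖ = 1 := Complex.norm_exp_ofReal_mul_I _

lemma halfDir_sq (t : ℝ) : halfDir t ^ 2 = Complex.exp (t * I) := by
  rw [halfDir, ← Complex.exp_nat_mul]
  push_cast
  ring_nf

lemma inner_halfDir (s t : ℝ) : inner ℝ (halfDir s) (halfDir t) = Real.cos ((t - s) / 2) := by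
  rw [sub_div, Real.cos_sub, inner_eq]
  simp only [halfDir, Complex.exp_ofReal_mul_I_re, Complex.exp_ofReal_mul_I_im]
  ring

lemma areaForm_halfDir (s t : ℝ) : ω (halfDir s) (halfDir t) = Real.sin ((t - s) / 2) := by
  rw [sub_div, Real.sin_sub, areaForm_eq]
  simp only [halfDir, Complex.exp_ofReal_mul_I_re, Complex.exp_ofReal_mul_I_im]
  ring

lemma eq_norm_smul_halfDir (hu : SameRay ℝ u (halfDir t)) : u = ‖u‖ • halfDir t := by
  simpa [norm_halfDir] using hu.norm_smul_eq.symm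

lemma inner_eq_of_sameRay_halfDir (hu : SameRay ℝ u (halfDir s)) (hv : SameRay ℝ v (halfDir t)) :
    inner ℝ u v = ‖u‖ * ‖v‖ * Real.cos ((t - s) / 2) := by
  conv_lhs => rw [eq_norm_smul_halfDir hu, eq_norm_smul_halfDir hv]
  rw [real_inner_smul_left, real_inner_smul_right, inner_halfDir, mul_assoc]

lemma areaForm_eq_of_sameRay_halfDir (hu : SameRay ℝ u (halfDir s))
    (hv : SameRay ℝ v (halfDir t)) : ω u v = ‖u‖ * ‖v‖ * Real.sin ((t - s) / 2) := by
  conv_lhs => rw [eq_norm_smul_halfDir hu, eq_norm_smul_halfDir hv]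
  rw [map_smul, LinearMap.map_smul₂, areaForm_halfDir, smul_eq_mul, smul_eq_mul]
  ring

lemma cos_half_sub_pos (h : |t - s| < Real.pi) : 0 < Real.cos ((t - s) / 2) := by
  obtain ⟨h₁, h₂⟩ := abs_lt.mp h
  exact Real.cos_pos_of_mem_Ioo ⟨by linarith, by linarith⟩

lemma exists_sameRay_halfDir_add (hu : SameRay ℝ u (halfDir s)) (hv : SameRay ℝ v (halfDir t))
    (h : |t - s| < Real.pi) : ∃ r ∈ uIcc s t, SameRay ℝ (u + v) (halfDir r) := by
  have harea (r : ℝ) : ω (u + v) (halfDir r) =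
      ‖u‖ * Real.sin ((r - s) / 2) + ‖v‖ * Real.sin ((r - t) / 2) := by
    rw [LinearMap.map_add₂, areaForm_eq_of_sameRay_halfDir hu (SameRay.refl _),
      areaForm_eq_of_sameRay_halfDir hv (SameRay.refl _), norm_halfDir, mul_one, mul_one]
  obtain ⟨r, hr, hr0⟩ : 0 ∈ (fun r => ω (u + v) (halfDir r)) '' uIcc s t := by
    refine intermediate_value_uIcc ?_ ?_
    · simp only [harea]
      fun_prop
    · have hsin : Real.sin ((s - t) / 2) = -Real.sin ((t - s) / 2) := by
        rw [← Real.sin_neg]; ring_nf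
      simp only [harea, sub_self, zero_div, Real.sin_zero, mul_zero, zero_add, add_zero, hsin]
      rw [mem_uIcc]
      rcases le_total 0 (Real.sin ((t - s) / 2)) with hsin0 | hsin0
      · exact Or.inl ⟨by nlinarith [norm_nonneg v], by positivity⟩
      · exact Or.inr ⟨by nlinarith [norm_nonneg u], by nlinarith [norm_nonneg v]⟩
  have hinner {w : ℂ} {x : ℝ} (hw : SameRay ℝ w (halfDir x)) (hx : x ∈ uIcc s t) :
      0 ≤ inner ℝ w (halfDir r) := by
    have hlt : |r - x| < Real.pi :=
      (abs_sub_le_of_uIcc_subset_uIcc (uIcc_subset_uIcc hx hr)).trans_lt h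
    rw [inner_eq_of_sameRay_halfDir hw (SameRay.refl _)]
    have := cos_half_sub_pos hlt
    positivity
  refine ⟨r, hr, (Complex.orientation.nonneg_inner_and_areaForm_eq_zero_iff_sameRay _ _).mp
    ⟨?_, hr0⟩⟩
  rw [inner_add_left]
  exact add_nonneg (hinner hu left_mem_uIcc) (hinner hv right_mem_uIcc)

end HalfDir

/-! ### Spinors -/

/-- The factor in `IsSpinor.centerVec_eq`: the radius of a disc, and `1` for a half-plane. -/
def GenDisc.scale : GenDisc → ℝ
  | .disc D => D.radius
  | .halfPlane _ _ _ => 1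

/-- `u` is a spinor of `C`, a circle tangent to `C₀`: one of the two square roots of the vector
from `C₀` to `C`, normalized such that tangency of two circles is a condition on the area that
their spinors span, and the successor of two circles has the sum of their spinors as a spinor. -/
structure IsSpinor (C₀ : RoundDisc) (C : GenDisc) (u : ℂ) : Prop where
  tangent : ExternallyTangent (.disc C₀) C
  centerVec_eq : centerVec C₀ C = (C₀.radius * C.scale) • u ^ 2

section Spinors

variable {C₀ : RoundDisc} {C C' : GenDisc} {u v : ℂ}

lemma GenDisc.scale_pos (C : GenDisc) : 0 < C.scale := by
  cases C with
  | disc D => exact D.radius_pos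
  | halfPlane => exact one_pos

lemma GenDisc.curvature_nonneg (C : GenDisc) : 0 ≤ C.curvature := by
  cases C with
  | disc D => exact (inv_pos.mpr D.radius_pos).le
  | halfPlane => exact le_rfl

lemma ExternallyTangent.symm (h : ExternallyTangent C C') : ExternallyTangent C' C := by
  cases C <;> cases C' <;> simp only [ExternallyTangent] at h ⊢
  · rw [dist_comm, h, add_comm]
  · exact h
  · exact h

lemma norm_centerVec (h : ExternallyTangent (.disc C₀) C) :
    ‖centerVec C₀ C‖ = C₀.radius * C.scale * (C₀.radius⁻¹ + C.curvature) := by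
  have hpos := C₀.radius_pos
  cases C with
  | disc D =>
    have hD := D.radius_pos
    rw [ExternallyTangent, dist_comm, dist_eq_norm] at h
    rw [centerVec, h, GenDisc.scale, GenDisc.curvature]
    field_simp
    ring
  | halfPlane n hn d =>
    rw [centerVec, hn, GenDisc.scale, GenDisc.curvature]
    field_simp
    ring

namespace IsSpinor

lemma norm_sq (h : IsSpinor C₀ C u) : ‖u‖ ^ 2 = C₀.radius⁻¹ + C.curvature := by
  have hpos : 0 < C₀.radius * C.scale := mul_pos C₀.radius_pos C.scale_pos
  refine mul_left_cancel₀ hpos.ne' ?_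
  rw [← norm_centerVec h.tangent, h.centerVec_eq, norm_smul, norm_pow, Real.norm_of_nonneg hpos.le]

lemma inv_radius_le (h : IsSpinor C₀ C u) : C₀.radius⁻¹ ≤ ‖u‖ ^ 2 := by
  linarith [h.norm_sq, C.curvature_nonneg]

lemma ne_zero (h : IsSpinor C₀ C u) : u ≠ 0 := by
  rintro rfl
  have hle := h.inv_radius_le
  have hpos := inv_pos.mpr C₀.radius_pos
  rw [norm_zero] at hle
  linarith

lemma neg (h : IsSpinor C₀ C u) : IsSpinor C₀ C (-u) := ⟨h.tangent, by rw [neg_sq, h.centerVec_eq]⟩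

lemma eq_or_eq_neg (hu : IsSpinor C₀ C u) (hv : IsSpinor C₀ C v) : u = v ∨ u = -v :=
  sq_eq_sq_iff_eq_or_eq_neg.mp <| smul_right_injective ℂ (mul_pos C₀.radius_pos C.scale_pos).ne' <|
    hu.centerVec_eq.symm.trans hv.centerVec_eq

end IsSpinor

lemma norm_smul_sq_sub_smul_sq_sq (a b : ℝ) (u v : ℂ) : ‖a • u ^ 2 - b • v ^ 2‖ ^ 2 =
    (a * ‖u‖ ^ 2 - b * ‖v‖ ^ 2) ^ 2 + 4 * (a * b) * ω u v ^ 2 := by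
  simp only [Complex.sq_norm, Complex.normSq_apply, areaForm_eq]
  simp only [pow_two, Complex.sub_re, Complex.sub_im, Complex.smul_re, Complex.smul_im,
    Complex.mul_re, Complex.mul_im, smul_eq_mul]
  ring

lemma inner_sq_sq (u v : ℂ) :
    inner ℝ (u ^ 2) (v ^ 2) = ‖u‖ ^ 2 * ‖v‖ ^ 2 - 2 * ω u v ^ 2 := by
  simp only [Complex.sq_norm, Complex.normSq_apply, areaForm_eq, inner_eq]
  simp only [pow_two, Complex.mul_re, Complex.mul_im]
  ring

lemma externallyTangent_disc_disc_iff {D E : RoundDisc} (hu : IsSpinor C₀ (.disc D) u)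
    (hv : IsSpinor C₀ (.disc E) v) :
    ExternallyTangent (.disc D) (.disc E) ↔ (C₀.radius * ω u v) ^ 2 = 1 := by
  have hpos := C₀.radius_pos
  have hD := D.radius_pos
  have hE := E.radius_pos
  have hdist : dist D.center E.center ^ 2 =
      (D.radius - E.radius) ^ 2 + 4 * D.radius * E.radius * (C₀.radius * ω u v) ^ 2 := by
    rw [dist_eq_norm, ← sub_sub_sub_cancel_right _ _ C₀.center]
    change ‖centerVec C₀ (.disc D) - centerVec C₀ (.disc E)‖ ^ 2 = _
    rw [hu.centerVec_eq, hv.centerVec_eq, norm_smul_sq_sub_smul_sq_sq, hu.norm_sq, hv.norm_sq]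
    simp only [GenDisc.scale, GenDisc.curvature]
    field_simp
    ring
  rw [ExternallyTangent, ← sq_eq_sq₀ dist_nonneg (by positivity), hdist]
  have hDE : 4 * D.radius * E.radius ≠ 0 := by positivity
  refine ⟨fun h => mul_left_cancel₀ hDE ?_, fun h => ?_⟩
  · linear_combination h
  · linear_combination 4 * D.radius * E.radius * h

lemma externallyTangent_disc_halfPlane_iff {D : RoundDisc} {n : ℂ} {hn : ‖n‖ = 1} {d : ℝ}
    (hu : IsSpinor C₀ (.disc D) u) (hv : IsSpinor C₀ (.halfPlane n hn d) v) :
    ExternallyTangent (.disc D) (.halfPlane n hn d) ↔ (C₀.radius * ω u v) ^ 2 = 1 := by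
  have hpos := C₀.radius_pos
  have hD := D.radius_pos
  have hC₀ : inner ℝ n C₀.center + C₀.radius = d := hv.tangent
  have hinner : inner ℝ n (D.center - C₀.center) =
      C₀.radius + D.radius - 2 * D.radius * (C₀.radius * ω u v) ^ 2 := by
    change inner ℝ (centerVec C₀ (.halfPlane n hn d)) (centerVec C₀ (.disc D)) = _
    rw [hu.centerVec_eq, hv.centerVec_eq, real_inner_smul_left, real_inner_smul_right,
      real_inner_comm, inner_sq_sq, hu.norm_sq, hv.norm_sq]
    simp only [GenDisc.scale, GenDisc.curvature]
    field_simp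
    ring
  rw [inner_sub_right] at hinner
  rw [ExternallyTangent]
  refine ⟨fun h => mul_left_cancel₀ hD.ne' ?_, fun h => ?_⟩
  · linarith
  · rw [h] at hinner
    linarith

lemma externallyTangent_disc_iff {D : RoundDisc} (hu : IsSpinor C₀ (.disc D) u)
    (hv : IsSpinor C₀ C v) : ExternallyTangent (.disc D) C ↔ (C₀.radius * ω u v) ^ 2 = 1 := by
  cases C with
  | disc E => exact externallyTangent_disc_disc_iff hu hv
  | halfPlane n hn d => exact externallyTangent_disc_halfPlane_iff hu hv

lemma ExternallyTangent.areaForm_sq (h : ExternallyTangent C C') (hu : IsSpinor C₀ C u)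
    (hv : IsSpinor C₀ C' v) : (C₀.radius * ω u v) ^ 2 = 1 := by
  cases C with
  | disc D => exact (externallyTangent_disc_iff hu hv).mp h
  | halfPlane =>
    cases C' with
    | disc E =>
      rw [Complex.orientation.areaForm_swap, mul_neg, neg_sq]
      exact (externallyTangent_disc_iff hv hu).mp h.symm
    | halfPlane => exact h.elim

lemma ExternallyTangent.areaForm_ne_zero (h : ExternallyTangent C C') (hu : IsSpinor C₀ C u)
    (hv : IsSpinor C₀ C' v) : ω u v ≠ 0 := fun h0 => by
  simpa [h0] using h.areaForm_sq hu hv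

lemma exists_isSpinor_disc (h : C₀.radius⁻¹ < ‖u‖ ^ 2) :
    ∃ S : RoundDisc, IsSpinor C₀ (.disc S) u := by
  have hpos := C₀.radius_pos
  obtain ⟨c, hc, hcu⟩ : ∃ c, 0 < c ∧ ‖u‖ ^ 2 = C₀.radius⁻¹ + c :=
    ⟨‖u‖ ^ 2 - C₀.radius⁻¹, sub_pos.mpr h, by ring⟩
  refine ⟨⟨C₀.center + (C₀.radius * c⁻¹) • u ^ 2, c⁻¹, inv_pos.mpr hc⟩, ?_, ?_⟩
  · rw [ExternallyTangent, dist_self_add_right, norm_smul, norm_pow, hcu,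
      Real.norm_of_nonneg (by positivity)]
    field_simp
    ring
  · simp [centerVec, GenDisc.scale]

lemma exists_isSuccessor (hu : IsSpinor C₀ C u) (hv : IsSpinor C₀ C' v)
    (h : ExternallyTangent C C') (hinner : 0 < inner ℝ u v) :
    ∃ S : RoundDisc, IsSpinor C₀ (.disc S) (u + v) ∧ IsSuccessor (.disc C₀) C C' S := by
  have hpos := inv_pos.mpr C₀.radius_pos
  have hnorm := norm_add_sq_real u v
  have hule := hu.inv_radius_le
  have hvle := hv.inv_radius_le
  obtain ⟨S, hS⟩ := exists_isSpinor_disc (C₀ := C₀) (u := u + v) (by linarith)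
  have hcurv := hS.norm_sq
  have harea := h.areaForm_sq hu hv
  refine ⟨S, hS, hS.tangent.symm, ?_, ?_, ?_, ?_, ?_⟩
  · rw [externallyTangent_disc_iff hS hu, ← harea, LinearMap.map_add₂,
      Complex.orientation.areaForm_apply_self, Complex.orientation.areaForm_swap v u]
    ring
  · rw [externallyTangent_disc_iff hS hv, ← harea, LinearMap.map_add₂,
      Complex.orientation.areaForm_apply_self]
    ring
  · change C₀.radius⁻¹ < _
    linarith
  · rw [IsSmaller]
    linarith [hu.norm_sq]
  · rw [IsSmaller]
    linarith [hv.norm_sq]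

lemma IsSpinor.coe_eq_angle {t : ℝ} (hu : IsSpinor C₀ C u) (ht : SameRay ℝ u (halfDir t)) :
    (t : Real.Angle) = angle C₀ C := by
  have hpos : 0 < C₀.radius * C.scale * ‖u‖ ^ 2 :=
    mul_pos (mul_pos C₀.radius_pos C.scale_pos) (pow_pos (norm_pos_iff.mpr hu.ne_zero) 2)
  rw [angle, hu.centerVec_eq, eq_norm_smul_halfDir ht, smul_pow, halfDir_sq, smul_smul,
    Complex.real_smul, Complex.exp_mul_I, ← Complex.ofReal_cos, ← Complex.ofReal_sin,
    ← Real.Angle.cos_coe, ← Real.Angle.sin_coe, Complex.arg_mul_cos_add_sin_mul_I_coe_angle hpos]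

lemma exists_isSpinor_sameRay_halfDir {t : ℝ} (h : ExternallyTangent (.disc C₀) C)
    (ht : (t : Real.Angle) = angle C₀ C) : ∃ u, IsSpinor C₀ C u ∧ SameRay ℝ u (halfDir t) := by
  have hexp : Complex.exp (t * I) = Complex.exp (Complex.arg (centerVec C₀ C) * I) := by
    simpa [angle, Real.Angle.toCircle_coe] using congrArg (fun θ => (θ.toCircle : ℂ)) ht
  have hnonneg : 0 ≤ C₀.radius⁻¹ + C.curvature :=
    add_nonneg (inv_pos.mpr C₀.radius_pos).le C.curvature_nonneg
  refine ⟨√(C₀.radius⁻¹ + C.curvature) • halfDir t, ⟨h, ?_⟩,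
    SameRay.sameRay_nonneg_smul_left _ (Real.sqrt_nonneg _)⟩
  rw [smul_pow, Real.sq_sqrt hnonneg, smul_smul, ← norm_centerVec h, halfDir_sq, hexp,
    Complex.real_smul, Complex.norm_mul_exp_arg_mul_I]

lemma exists_isSpinor (h : ExternallyTangent (.disc C₀) C) : ∃ u, IsSpinor C₀ C u :=
  (exists_isSpinor_sameRay_halfDir h rfl).imp fun _ => And.left

end Spinors

/-! ### Apollonian curves -/

lemma frame_cutLeft (o x y z : ℂ) : frame o x y (cutLeft z) =
    frame (o + (2 / 3 : ℝ) • x) ((1 / 3 : ℝ) • x) ((1 / 3 : ℝ) • (y - x)) z := by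
  rw [frame_apply, frame_apply, cutLeft_re, cutLeft_im]
  module

lemma frame_cutRight (o x y z : ℂ) : frame o x y (cutRight z) =
    frame (o + (2 / 3 : ℝ) • y) ((1 / 3 : ℝ) • (x - y)) ((1 / 3 : ℝ) • y) z := by
  rw [frame_apply, frame_apply, cutRight_re, cutRight_im]
  module

namespace ApollonianCurve

/-- The circle `C` of the family of the curve `g` is met at the angle `t` of the parameter interval
of `g`, and `u` is the spinor of `C` of argument `t / 2`. -/
structure Marks {C₀ : RoundDisc} {C₁ C₂ : GenDisc} (g : ApollonianCurve C₀ C₁ C₂) (C : GenDisc)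
    (t : ℝ) (u : ℂ) : Prop where
  family : Family C₀ C₁ C₂ C
  mem : t ∈ uIcc g.a g.b
  spinor : IsSpinor C₀ C u
  sameRay : SameRay ℝ u (halfDir t)

/-- The part of the curve `g` between the angles `t` and `t'` of two tangent circles, with spinors
`u` and `v`; its chord is `lam` times the spinor `u + v` of their successor. -/
structure IsSubarc {C₀ : RoundDisc} {C₁ C₂ : GenDisc} (g : ApollonianCurve C₀ C₁ C₂) (t : ℝ) (u : ℂ)
    (t' : ℝ) (v : ℂ) (lam : ℝ) : Prop where
  exists_circles : ∃ C C', ExternallyTangent C C' ∧ g.Marks C t u ∧ g.Marks C' t' v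
  sub_eq : g.γ t - g.γ t' = lam • (u + v)

variable {C₀ : RoundDisc} {C₁ C₂ C C' : GenDisc} {g : ApollonianCurve C₀ C₁ C₂} {t t' lam : ℝ}
  {u v : ℂ}

lemma isCompact_image (g : ApollonianCurve C₀ C₁ C₂) : IsCompact g.image :=
  isCompact_uIcc.image_of_continuousOn g.continuousOn

namespace Marks

lemma abs_sub_lt (hu : g.Marks C t u) (hv : g.Marks C' t' v) : |t' - t| < Real.pi :=
  (abs_sub_le_of_uIcc_subset_uIcc (uIcc_subset_uIcc hu.mem hv.mem)).trans_lt g.length_lt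

lemma inner_pos (hu : g.Marks C t u) (hv : g.Marks C' t' v) : 0 < inner ℝ u v := by
  rw [inner_eq_of_sameRay_halfDir hu.sameRay hv.sameRay]
  have hcos := cos_half_sub_pos (hu.abs_sub_lt hv)
  have hupos := norm_pos_iff.mpr hu.spinor.ne_zero
  have hvpos := norm_pos_iff.mpr hv.spinor.ne_zero
  positivity

lemma exists_successor (hu : g.Marks C t u) (hv : g.Marks C' t' v) (h : ExternallyTangent C C') :
    ∃ S, IsSuccessor (.disc C₀) C C' S ∧ ∃ s ∈ uIcc t t', g.Marks (.disc S) s (u + v) := by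
  obtain ⟨S, hS, hsucc⟩ := exists_isSuccessor hu.spinor hv.spinor h (hu.inner_pos hv)
  obtain ⟨s, hs, hray⟩ := exists_sameRay_halfDir_add hu.sameRay hv.sameRay (hu.abs_sub_lt hv)
  exact ⟨S, hsucc, s, hs, .succ hu.family hv.family h hsucc, uIcc_subset_uIcc hu.mem hv.mem hs, hS,
    hray⟩

lemma exists_isSubarc (hu : g.Marks C t u) (hv : g.Marks C' t' v) (h : ExternallyTangent C C') :
    ∃ lam, g.IsSubarc t u t' v lam := by
  obtain ⟨S, hS, hsucc⟩ := exists_isSuccessor hu.spinor hv.spinor h (hu.inner_pos hv)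
  obtain ⟨w, hw, c, hc⟩ := g.sub_mem C C' hu.family hv.family h S hsucc t hu.mem t' hv.mem
    (hu.spinor.coe_eq_angle hu.sameRay) (hv.spinor.coe_eq_angle hv.sameRay)
  have hsq : w ^ 2 = (√(C₀.radius * S.radius) • (u + v)) ^ 2 := by
    rw [smul_pow, Real.sq_sqrt (mul_pos C₀.radius_pos S.radius_pos).le, hw]
    exact hS.centerVec_eq
  rw [← Complex.real_smul] at hc
  rcases sq_eq_sq_iff_eq_or_eq_neg.mp hsq with rfl | rfl
  · exact ⟨c * √(C₀.radius * S.radius), ⟨C, C', h, hu, hv⟩, by rw [hc, mul_smul]⟩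
  · exact ⟨-(c * √(C₀.radius * S.radius)), ⟨C, C', h, hu, hv⟩, by rw [hc]; module⟩

end Marks

/-- The affine map that carries the model curve to a subarc of `g`. -/
noncomputable def subarcFrame (g : ApollonianCurve C₀ C₁ C₂) (t : ℝ) (u v : ℂ) (lam : ℝ) :
    ℂ →ᵃ[ℝ] ℂ :=
  frame (g.γ t - lam • u) (lam • u) (-lam • v)

lemma subarcFrame_one : g.subarcFrame t u v lam 1 = g.γ t := by simp [subarcFrame]

lemma subarcFrame_cutLeft (z : ℂ) :
    g.subarcFrame t u v lam (cutLeft z) = g.subarcFrame t u (u + v) (lam / 3) z := by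
  rw [subarcFrame, frame_cutLeft, subarcFrame]
  congr 2 <;> module

namespace IsSubarc

lemma subarcFrame_I (h : g.IsSubarc t u t' v lam) : g.subarcFrame t u v lam I = g.γ t' := by
  rw [subarcFrame, frame_I, ← sub_sub_cancel (g.γ t) (g.γ t'), h.sub_eq]
  module

lemma subarcFrame_cutRight {s : ℝ} (h : g.IsSubarc t u s (u + v) (lam / 3)) (z : ℂ) :
    g.subarcFrame t u v lam (cutRight z) = g.subarcFrame s (u + v) v (lam / 3) z := by
  rw [subarcFrame, frame_cutRight, subarcFrame, ← sub_sub_cancel (g.γ t) (g.γ s), h.sub_eq]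
  congr 2 <;> module

lemma exists_split (h : g.IsSubarc t u t' v lam) : ∃ s ∈ uIcc t t',
    g.IsSubarc t u s (u + v) (lam / 3) ∧ g.IsSubarc s (u + v) t' v (lam / 3) := by
  obtain ⟨C, C', hCC', hu, hv⟩ := h.exists_circles
  obtain ⟨S, hsucc, s, hs, hS⟩ := hu.exists_successor hv hCC'
  obtain ⟨α, hα⟩ := hu.exists_isSubarc hS hsucc.tangent₂.symm
  obtain ⟨β, hβ⟩ := hS.exists_isSubarc hv hsucc.tangent₃
  have hne : ω u v ≠ 0 := hCC'.areaForm_ne_zero hu.spinor hv.spinor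
  have hsum : α • (u + (u + v)) + β • (u + v + v) = lam • (u + v) := by
    rw [← hα.sub_eq, ← hβ.sub_eq, ← h.sub_eq, sub_add_sub_cancel]
  have hleft : α + 2 * β = lam := by
    have := congrArg (ω u) hsum
    simp only [map_add, map_smul, Complex.orientation.areaForm_apply_self, smul_eq_mul] at this
    exact mul_right_cancel₀ hne (by linear_combination this)
  have hright : 2 * α + β = lam := by
    have := congrArg (ω · v) hsum
    simp only [map_add, map_smul, LinearMap.add_apply, LinearMap.smul_apply,
      Complex.orientation.areaForm_apply_self, smul_eq_mul] at this
    exact mul_right_cancel₀ hne (by linear_combination this)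
  obtain rfl : α = lam / 3 := by linarith
  obtain rfl : β = lam / 3 := by linarith
  exact ⟨s, hs, hα, hβ⟩

lemma subarcFrame_mem_image {z : ℂ} (hz : IsCurveVertex z) (h : g.IsSubarc t u t' v lam) :
    g.subarcFrame t u v lam z ∈ g.image := by
  induction hz generalizing t u t' v lam with
  | one =>
    obtain ⟨_, _, -, hu, -⟩ := h.exists_circles
    exact ⟨t, hu.mem, subarcFrame_one.symm⟩
  | I =>
    obtain ⟨_, _, -, -, hv⟩ := h.exists_circles
    exact ⟨t', hv.mem, h.subarcFrame_I.symm⟩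
  | cutLeft _ ih =>
    obtain ⟨s, -, hleft, -⟩ := h.exists_split
    rw [subarcFrame_cutLeft]
    exact ih hleft
  | cutRight _ ih =>
    obtain ⟨s, -, hleft, hright⟩ := h.exists_split
    rw [hleft.subarcFrame_cutRight]
    exact ih hright

lemma norm_sq_add_le (h : g.IsSubarc t u t' v lam) :
    ‖u‖ ^ 2 + ‖v‖ ^ 2 ≤ ‖u + v‖ ^ 2 := by
  obtain ⟨C, C', -, hu, hv⟩ := h.exists_circles
  linarith [norm_add_sq_real u v, hu.inner_pos hv]

lemma inv_radius_le (h : g.IsSubarc t u t' v lam) :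
    C₀.radius⁻¹ ≤ ‖u‖ ^ 2 ∧ C₀.radius⁻¹ ≤ ‖v‖ ^ 2 := by
  obtain ⟨C, C', -, hu, hv⟩ := h.exists_circles
  exact ⟨hu.spinor.inv_radius_le, hv.spinor.inv_radius_le⟩

lemma exists_isSubarc_of_mem (n : ℕ) {x : ℝ} (h : g.IsSubarc t u t' v lam) (hx : x ∈ uIcc t t') :
    ∃ s p s' q lam', g.IsSubarc s p s' q lam' ∧ x ∈ uIcc s s' ∧
      ‖u‖ ^ 2 + ‖v‖ ^ 2 + C₀.radius⁻¹ * n ≤ ‖p‖ ^ 2 + ‖q‖ ^ 2 ∧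
      ∃ z, IsCurveVertex z ∧ g.subarcFrame t u v lam z = g.γ s := by
  induction n generalizing t u t' v lam with
  | zero => exact ⟨t, u, t', v, lam, h, hx, by simp, 1, IsCurveVertex.one, subarcFrame_one⟩
  | succ n ih =>
    obtain ⟨r, -, hleft, hright⟩ := h.exists_split
    have hgrowth := h.norm_sq_add_le
    obtain ⟨hu, hv⟩ := h.inv_radius_le
    push_cast
    rcases uIcc_subset_uIcc_union_uIcc (b := r) hx with hx | hx
    · obtain ⟨s, p, s', q, lam', hsub, hxs, hnorm, z, hz, hzs⟩ := ih hleft hx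
      refine ⟨s, p, s', q, lam', hsub, hxs, by linarith, cutLeft z, hz.cutLeft, ?_⟩
      rw [subarcFrame_cutLeft, hzs]
    · obtain ⟨s, p, s', q, lam', hsub, hxs, hnorm, z, hz, hzs⟩ := ih hright hx
      refine ⟨s, p, s', q, lam', hsub, hxs, by linarith, cutRight z, hz.cutRight, ?_⟩
      rw [hleft.subarcFrame_cutRight, hzs]

lemma norm_sq_mul_norm_sq_mul_sin_sq (h : g.IsSubarc t u t' v lam) :
    ‖u‖ ^ 2 * ‖v‖ ^ 2 * Real.sin ((t' - t) / 2) ^ 2 = C₀.radius⁻¹ ^ 2 := by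
  obtain ⟨C, C', hCC', hu, hv⟩ := h.exists_circles
  have hpos := C₀.radius_pos
  have harea := hCC'.areaForm_sq hu.spinor hv.spinor
  rw [areaForm_eq_of_sameRay_halfDir hu.sameRay hv.sameRay] at harea
  field_simp
  linear_combination harea

lemma sq_sub_le_mul_sin_sq (h : g.IsSubarc t u t' v lam) :
    (t' - t) ^ 2 ≤ Real.pi ^ 2 * Real.sin ((t' - t) / 2) ^ 2 := by
  obtain ⟨C, C', -, hu, hv⟩ := h.exists_circles
  have hjordan := Real.mul_abs_le_abs_sin (x := (t' - t) / 2) (by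
    rw [abs_div, abs_two]
    linarith [hu.abs_sub_lt hv])
  rw [abs_div, abs_two] at hjordan
  have habs : |t' - t| ≤ Real.pi * |Real.sin ((t' - t) / 2)| := by
    calc |t' - t| = Real.pi * (2 / Real.pi * (|t' - t| / 2)) := by field_simp
      _ ≤ Real.pi * |Real.sin ((t' - t) / 2)| := by gcongr
  rw [← sq_abs (t' - t), ← sq_abs (Real.sin _), ← mul_pow]
  gcongr

lemma sq_sub_le (h : g.IsSubarc t u t' v lam) {n : ℝ} (hn : 0 < n)
    (hnorm : C₀.radius⁻¹ * n ≤ ‖u‖ ^ 2 + ‖v‖ ^ 2) : (t' - t) ^ 2 ≤ 2 * Real.pi ^ 2 / n := by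
  obtain ⟨hu, hv⟩ := h.inv_radius_le
  have hk := inv_pos.mpr C₀.radius_pos
  have hprod : C₀.radius⁻¹ ^ 2 * (n / 2) ≤ ‖u‖ ^ 2 * ‖v‖ ^ 2 := by nlinarith
  have hsin : Real.sin ((t' - t) / 2) ^ 2 ≤ 2 / n := by
    rw [le_div_iff₀ hn]
    refine le_of_mul_le_mul_left (a := C₀.radius⁻¹ ^ 2) ?_ (by positivity)
    nlinarith [h.norm_sq_mul_norm_sq_mul_sin_sq,
      mul_le_mul_of_nonneg_right hprod (sq_nonneg (Real.sin ((t' - t) / 2)))]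
  calc (t' - t) ^ 2 ≤ Real.pi ^ 2 * Real.sin ((t' - t) / 2) ^ 2 := h.sq_sub_le_mul_sin_sq
    _ ≤ Real.pi ^ 2 * (2 / n) := by gcongr
    _ = 2 * Real.pi ^ 2 / n := by ring

lemma mem_closure_setOf_mem_image {x : ℝ} (h : g.IsSubarc t u t' v lam) (hx : x ∈ uIcc t t') :
    x ∈ closure {s ∈ uIcc g.a g.b | g.γ s ∈ g.subarcFrame t u v lam '' modelCurve} := by
  refine Metric.mem_closure_iff.mpr fun ε hε => ?_
  obtain ⟨n, hn⟩ := exists_nat_gt (2 * Real.pi ^ 2 / ε ^ 2)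
  have hn0 : (0 : ℝ) < n := lt_of_le_of_lt (by positivity) hn
  obtain ⟨s, p, s', q, lam', hsub, hxs, hnorm, z, hz, hzs⟩ := h.exists_isSubarc_of_mem n hx
  obtain ⟨_, _, -, hs, -⟩ := hsub.exists_circles
  refine ⟨s, ⟨hs.mem, z, subset_closure hz, hzs⟩, ?_⟩
  calc dist x s ≤ |s' - s| := by
        rw [Real.dist_eq]
        exact abs_sub_left_of_mem_uIcc hxs
    _ < ε := abs_lt_of_sq_lt_sq (?_ : (s' - s) ^ 2 < ε ^ 2) hε.le
  have hlarge : C₀.radius⁻¹ * n ≤ ‖p‖ ^ 2 + ‖q‖ ^ 2 :=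
    (le_add_of_nonneg_left (by positivity)).trans hnorm
  calc (s' - s) ^ 2 ≤ 2 * Real.pi ^ 2 / n := hsub.sq_sub_le hn0 hlarge
    _ < ε ^ 2 := by rwa [div_lt_comm₀ hn0 (by positivity)]

lemma image_eq (h : g.IsSubarc g.a u g.b v lam) :
    g.image = g.subarcFrame g.a u v lam '' modelCurve := by
  have hcont : Continuous (g.subarcFrame g.a u v lam) := continuous_frame _ _ _
  refine subset_antisymm ?_ ?_
  · rintro _ ⟨x, hx, rfl⟩
    have hmem := ((g.continuousOn x hx).mono (sep_subset _ _)).mem_closure_image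
      (h.mem_closure_setOf_mem_image hx)
    refine closure_minimal ?_ (isCompact_modelCurve.image hcont).isClosed hmem
    rintro _ ⟨s, hs, rfl⟩
    exact hs.2
  · rw [image_subset_iff]
    exact closure_minimal (fun z hz => h.subarcFrame_mem_image hz)
      (g.isCompact_image.isClosed.preimage hcont)

end IsSubarc

lemma exists_image_eq (g : ApollonianCurve C₀ C₁ C₂) (h : ExternallyTangent C₁ C₂)
    (hu : IsSpinor C₀ C₁ u) (hv : IsSpinor C₀ C₂ v) (hinner : inner ℝ u v < 0) :
    ∃ lam : ℝ, g.source - g.target = lam • (u - v) ∧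
      g.image = frame (g.source - lam • u) (lam • u) (lam • v) '' modelCurve := by
  obtain ⟨x, hx, hxray⟩ := exists_isSpinor_sameRay_halfDir hu.tangent g.angle_a
  obtain ⟨y, hy, hyray⟩ := exists_isSpinor_sameRay_halfDir hv.tangent g.angle_b
  have hxm : g.Marks C₁ g.a x := ⟨.left, left_mem_uIcc, hx, hxray⟩
  have hym : g.Marks C₂ g.b y := ⟨.right, right_mem_uIcc, hy, hyray⟩
  have hpos := hxm.inner_pos hym
  obtain ⟨lam, hlam⟩ := hxm.exists_isSubarc hym h
  have hsub : g.source - g.target = lam • (x + y) := hlam.sub_eq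
  have himage : g.image = frame (g.source - lam • x) (lam • x) (-lam • y) '' modelCurve :=
    hlam.image_eq
  rcases hx.eq_or_eq_neg hu with rfl | rfl <;> rcases hy.eq_or_eq_neg hv with rfl | rfl
  · linarith
  · refine ⟨lam, by rw [hsub, sub_eq_add_neg], by rw [himage, neg_smul_neg]⟩
  · exact ⟨-lam, by rw [hsub]; module, by rw [himage, smul_neg, ← neg_smul]⟩
  · rw [inner_neg_neg] at hpos
    linarith

end ApollonianCurve

/-! ### Proper Apollonian triangles -/

section Triangles

variable {x y z : ℂ} {C₀ : RoundDisc} {C₁ C₂ C₃ : GenDisc}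

lemma areaForm_smul_eq (x y z : ℂ) : ω x y • z = ω z y • x + ω x z • y := by
  apply Complex.ext <;>
  · simp only [areaForm_eq, Complex.smul_re, Complex.smul_im, Complex.add_re, Complex.add_im,
      smul_eq_mul]
    ring

lemma eq_or_eq_neg_of_areaForm_sq_eq (hne : ω x y ≠ 0) (hxz : ω x z ^ 2 = ω x y ^ 2)
    (hzy : ω z y ^ 2 = ω x y ^ 2) : (z = x + y ∨ z = -(x + y)) ∨ z = x - y ∨ z = -(x - y) := by
  have hz := areaForm_smul_eq x y z
  have hcancel {w : ℂ} (hw : ω x y • z = ω x y • w) : z = w := smul_right_injective ℂ hne hw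
  rcases sq_eq_sq_iff_eq_or_eq_neg.mp hxz with h₁ | h₁ <;>
    rcases sq_eq_sq_iff_eq_or_eq_neg.mp hzy with h₂ | h₂ <;> rw [h₁, h₂] at hz
  · exact Or.inl (Or.inl (hcancel (by rw [hz]; module)))
  · exact Or.inr (Or.inr (hcancel (by rw [hz]; module)))
  · exact Or.inr (Or.inl (hcancel (by rw [hz]; module)))
  · exact Or.inl (Or.inr (hcancel (by rw [hz]; module)))

lemma norm_sq_lt_of_isSmaller (hx : IsSpinor C₀ C₁ x) (hy : IsSpinor C₀ C₂ y)
    (hz : IsSpinor C₀ C₃ z) (h : IsSmaller C₀ C₃) : ‖z‖ ^ 2 < ‖x‖ ^ 2 + ‖y‖ ^ 2 := by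
  have hcurv : C₃.curvature < C₀.radius⁻¹ := h
  linarith [hz.norm_sq, hx.inv_radius_le, hy.inv_radius_le]

lemma exists_isSpinor_add_add_eq_zero (h₁₂ : ExternallyTangent C₁ C₂)
    (h₂₃ : ExternallyTangent C₂ C₃) (h₃₁ : ExternallyTangent C₃ C₁) (h : IsProper C₀ C₁ C₂ C₃) :
    ∃ x y z, IsSpinor C₀ C₁ x ∧ IsSpinor C₀ C₂ y ∧ IsSpinor C₀ C₃ z ∧ x + y + z = 0 := by
  obtain ⟨x, hx⟩ := exists_isSpinor h.tangent₁
  obtain ⟨z, hz⟩ := exists_isSpinor h.tangent₃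
  obtain ⟨y, hy, hxy⟩ : ∃ y, IsSpinor C₀ C₂ y ∧ inner ℝ x y ≤ 0 := by
    obtain ⟨y, hy⟩ := exists_isSpinor h.tangent₂
    rcases le_total (inner ℝ x y) 0 with hinner | hinner
    · exact ⟨y, hy, hinner⟩
    · exact ⟨-y, hy.neg, by rwa [inner_neg_right, neg_nonpos]⟩
  have hne : z ≠ x - y ∧ z ≠ -(x - y) := by
    constructor <;> rintro rfl <;> have hlt := norm_sq_lt_of_isSmaller hx hy hz h.smaller₃
    · linarith [norm_sub_sq_real x y]
    · linarith [norm_sub_sq_real x y, congrArg (· ^ 2) (norm_neg (x - y))]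
  have harea {a b : ℝ} (ha : (C₀.radius * a) ^ 2 = 1) (hb : (C₀.radius * b) ^ 2 = 1) :
      a ^ 2 = b ^ 2 := by
    rw [mul_pow] at ha hb
    exact mul_left_cancel₀ (pow_ne_zero 2 C₀.radius_pos.ne') (ha.trans hb.symm)
  have hxy_sq := h₁₂.areaForm_sq hx hy
  rcases eq_or_eq_neg_of_areaForm_sq_eq (h₁₂.areaForm_ne_zero hx hy)
    (harea (h₃₁.symm.areaForm_sq hx hz) hxy_sq) (harea (h₂₃.symm.areaForm_sq hz hy) hxy_sq)
    with (rfl | rfl) | hz'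
  · exact ⟨x, y, -(x + y), hx, hy, hz.neg, add_neg_cancel _⟩
  · exact ⟨x, y, -(x + y), hx, hy, hz, add_neg_cancel _⟩
  · exact (hz'.elim hne.1 hne.2).elim

lemma inner_neg_of_add_add_eq_zero (hx : IsSpinor C₀ C₁ x) (hy : IsSpinor C₀ C₂ y)
    (hz : IsSpinor C₀ C₃ z) (hsum : x + y + z = 0) (h : IsSmaller C₀ C₃) : inner ℝ x y < 0 := by
  have hlt := norm_sq_lt_of_isSmaller hx hy hz h
  rw [← norm_neg z, ← eq_neg_of_add_eq_zero_left hsum, norm_add_sq_real] at hlt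
  linarith

lemma eq_of_smul_sub_add_smul_sub_eq_zero {a b c : ℝ} (hne : ω x y ≠ 0) (hsum : x + y + z = 0)
    (h : a • (x - y) + b • (y - z) + c • (z - x) = 0) : a = b ∧ a = c := by
  obtain rfl : z = -(x + y) := eq_neg_of_add_eq_zero_right hsum
  have hx := congrArg (ω x) h
  have hy := congrArg (ω y) h
  simp only [map_add, map_sub, map_neg, map_smul, Complex.orientation.areaForm_apply_self, map_zero,
    smul_eq_mul, Complex.orientation.areaForm_swap y x] at hx hy
  have hb : -a + 2 * b - c = 0 := mul_right_cancel₀ hne (by linear_combination hx)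
  have hc : a + b - 2 * c = 0 := mul_right_cancel₀ hne (by linear_combination -hy)
  constructor <;> linarith

lemma exists_eq_add_smul_of_sub_eq_smul {a b c : ℝ} {p q r : ℂ} (hne : ω x y ≠ 0)
    (hsum : x + y + z = 0) (hpq : p - q = a • (x - y)) (hqr : q - r = b • (y - z))
    (hrp : r - p = c • (z - x)) :
    a = b ∧ a = c ∧ ∃ o, p = o + a • x ∧ q = o + a • y ∧ r = o + a • z := by
  obtain ⟨rfl, rfl⟩ := eq_of_smul_sub_add_smul_sub_eq_zero hne hsum
    (by rw [← hpq, ← hqr, ← hrp]; ring)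
  refine ⟨rfl, rfl, p - a • x, by module, ?_, ?_⟩
  · rw [← sub_sub_cancel p q, hpq]
    module
  · rw [← sub_add_cancel r p, hrp]
    module

lemma frame_image_modelBoundary (o x y : ℂ) : frame o x y '' modelBoundary =
    frame o x y '' modelCurve ∪ frame o y (-x - y) '' modelCurve ∪
      frame o (-x - y) x '' modelCurve := by
  have hcyc (x y : ℂ) (A : Set ℂ) : frame o x y '' (cyc '' A) = frame o y (-x - y) '' A := by
    rw [image_image]
    refine image_congr fun z _ => ?_
    rw [frame_apply, frame_apply, cyc_re, cyc_im]
    module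
  rw [modelBoundary, image_union, image_union, hcyc, hcyc, hcyc]
  ring_nf

lemma IsApollonianTriangle.exists_eq_frame_image {p₁ p₂ p₃ : ℂ} {T : Set ℂ}
    (hT : IsApollonianTriangle C₀ C₁ C₂ C₃ p₁ p₂ p₃ T) (hproper : IsProper C₀ C₁ C₂ C₃) :
    ∃ o x y, (ω x y ≠ 0 ∨ x = 0 ∧ y = 0) ∧ p₁ = o + x ∧ p₂ = o + y ∧ p₃ = o - x - y ∧
      T = enclosedRegion (frame o x y '' modelBoundary) := by
  obtain ⟨h₁₂, h₂₃, h₃₁, -, -, -, γ₁₂, γ₂₃, γ₃₁, rfl, hs₁₂, rfl, hs₂₃, rfl, hs₃₁, rfl⟩ := hT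
  obtain ⟨x, y, z, hx, hy, hz, hsum⟩ := exists_isSpinor_add_add_eq_zero h₁₂ h₂₃ h₃₁ hproper
  have hne : ω x y ≠ 0 := h₁₂.areaForm_ne_zero hx hy
  obtain ⟨c, h₁₂_sub, h₁₂_image⟩ := γ₁₂.exists_image_eq h₁₂ hx hy
    (inner_neg_of_add_add_eq_zero hx hy hz hsum hproper.smaller₃)
  obtain ⟨c₂, h₂₃_sub, h₂₃_image⟩ := γ₂₃.exists_image_eq h₂₃ hy hz
    (inner_neg_of_add_add_eq_zero hy hz hx (by rw [← hsum]; ring) hproper.smaller₁)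
  obtain ⟨c₃, h₃₁_sub, h₃₁_image⟩ := γ₃₁.exists_image_eq h₃₁ hz hx
    (inner_neg_of_add_add_eq_zero hz hx hy (by rw [← hsum]; ring) hproper.smaller₂)
  rw [hs₁₂] at h₁₂_sub h₁₂_image
  rw [hs₂₃] at h₂₃_sub h₂₃_image
  rw [hs₃₁] at h₃₁_sub h₃₁_image
  obtain ⟨rfl, rfl, o, hp₁, hp₂, hp₃⟩ :=
    exists_eq_add_smul_of_sub_eq_smul hne hsum h₁₂_sub h₂₃_sub h₃₁_sub
  have hcz : c • z = -(c • x) - c • y := by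
    rw [eq_neg_of_add_eq_zero_right hsum]
    module
  refine ⟨o, c • x, c • y, ?_, hp₁, hp₂, by rw [hp₃, hcz]; ring, ?_⟩
  · rcases eq_or_ne c 0 with rfl | hc
    · exact Or.inr ⟨zero_smul ℝ x, zero_smul ℝ y⟩
    · refine Or.inl ?_
      rw [map_smul, LinearMap.map_smul₂, smul_eq_mul, smul_eq_mul]
      exact mul_ne_zero hc (mul_ne_zero hc hne)
  · rw [frame_image_modelBoundary, h₁₂_image, h₂₃_image, h₃₁_image, hp₁, hp₂, hp₃, ← hcz]
    simp only [add_sub_cancel_right]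

end Triangles

end Apollonian

theorem lemma6 (C₀ : Apollonian.RoundDisc) (C₁ C₂ C₃ : Apollonian.GenDisc) (p₁ p₂ p₃ : ℂ)
    (T : Set ℂ) (hT : Apollonian.IsApollonianTriangle C₀ C₁ C₂ C₃ p₁ p₂ p₃ T)
    (hproper : Apollonian.IsProper C₀ C₁ C₂ C₃) :
    MeasureTheory.volume T =
      (4 / 7 : ENNReal) * MeasureTheory.volume (convexHull ℝ ({p₁, p₂, p₃} : Set ℂ)) := by
  obtain ⟨o, x, y, hxy, rfl, rfl, rfl, rfl⟩ := hT.exists_eq_frame_image hproper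
  exact Apollonian.volume_enclosedRegion_frame_image hxy
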